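/- Let $B$ be a smooth Hausdorff manifold modelled on a real normed space (of finite or infinite dimension), let $\mathcal{A}$ be an affine space (a real normed space regarded as a manifold), and let $\pi:\mathcal{A}\to B$ be a smooth fibre bundle. Let $\{U_\lambda\}_{\lambda\in\Lambda}$, with $\Lambda$ linearly ordered, be a good open covering of $B$ (all non-empty finite intersections $U_{\lambda_0\dots\lambda_p}=U_{\lambda_0}\cap\dots\cap U_{\lambda_p}$ are smoothly contractible) that admits a subordinate smooth partition of unity. All forms are smooth and $\mathbb{C}$-valued. Let $\check H^{n}_{dR}(B)$ be the cohomology of the Čech–de Rham complex of the covering, whose cochains of degree $n$ are families of $q$-forms on the sets $U_{\lambda_0\dots\lambda_p}$, $\lambda_0<\dots<\lambda_p$, $p+q=n$, with coboundary operator $\delta+(-1)^pd$; for $p+q=n$ let $\check H^{n}_{dR}(B)_{(p,q)}$ be the subgroup of the classes of cocycles concentrated in bidegree $(p,q)$. Let $H^k_{dR}(\mathcal{A}\to B)$ be the cohomology of the complex $\Omega^*(\mathcal{A})/\pi^*\Omega^*(B)$ with the operator induced by the exterior derivative. Let $\tilde\Omega^k$ be the group of the families $\tilde\omega=\{\tilde\omega_\lambda\}$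 of $k$-forms on the sets $\pi^{-1}(U_\lambda)$ of the form $$\tilde\omega_\lambda=\hat\omega|_{\pi^{-1}(U_\lambda)}-\pi^*\omega_\lambda,\qquad \hat\omega\in\Omega^k(\mathcal{A}),\ \omega_\lambda\in\Omega^k(U_\lambda),$$ and let $\tilde H^k(\mathcal{A}\to B)$ be the cohomology of the complex $\tilde\Omega^*$ with the exterior derivative. Then for every $k\ge 1$ there are $\mathbb{C}$-linear isomorphisms $$\tilde H^k(\mathcal{A}\to B)\cong\check H^{k+1}_{dR}(B)_{(1,k)},\qquad \tilde H^k(\mathcal{A}\to B)\cong\check H^{k+1}_{dR}(B)_{(0,k+1)},\qquad \tilde H^k(\mathcal{A}\to B)\cong H^k_{dR}(\mathcal{A}\to B)$$ which, for every cocycle $\tilde\omega\in\tilde\Omega^k$ and every choice of a decomposition $\tilde\omega_\lambda=\hat\omega|_{\pi^{-1}(U_\lambda)}-\pi^*\omega_\lambda$, map the class $[\tilde\omega]$ to $[\{\omega_\mu-\omega_\lambda\}_{\lambda<\mu}]$ (with $\omega_\mu-\omega_\lambda$ a form on $U_\lambda\cap U_\mu$), to $[\{d\omega_\lambda\}]$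 and to $[\hat\omega]$, respectively. In particular, these families and forms are cocycles, and their classes do not depend on the decomposition. -/

import Mathlib

open scoped Manifold ContDiff Topology
open Set TopologicalSpace

set_option linter.unusedSectionVars false

noncomputable section
namespace CechDeRham

section Alternating
variable {E F : Type*} [NormedAddCommGroup E] [NormedSpace ℝ E]
  [NormedAddCommGroup F] [NormedSpace ℝ F] {k : ℕ}

/-- Alternatization as a continuous linear map. -/
def altCLM (E : Type*) [NormedAddCommGroup E] [NormedSpace ℝ E] (k : ℕ) :
    ContinuousMultilinearMap ℝ (fun _ : Fin k => E) ℂ →L[ℝ] E [⋀^Fin k]→L[ℝ] ℂ :=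
  LinearMap.mkContinuous
    { toFun := fun f => ContinuousMultilinearMap.alternatization f
      map_add' := fun f g => map_add _ f g
      map_smul' := fun c f => by
        ext v
        simp [ContinuousMultilinearMap.alternatization_apply_apply, Finset.smul_sum,
          smul_comm c] }
    (Nat.factorial k) (fun f => by
      refine ContinuousAlternatingMap.opNorm_le_bound _ (by positivity) fun v => ?_
      simp only [LinearMap.coe_mk, AddHom.coe_mk,
        ContinuousMultilinearMap.alternatization_apply_apply]
      refine (norm_sum_le _ _).trans ?_
      have : ∀ σ ∈ (Finset.univ : Finset (Equiv.Perm (Fin k))),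
          ‖Equiv.Perm.sign σ • f (v ∘ σ)‖ ≤ ‖f‖ * ∏ i, ‖v i‖ := by
        intro σ _
        have h1 : ‖Equiv.Perm.sign σ • f (v ∘ σ)‖ = ‖f (v ∘ σ)‖ := by
          rcases Int.units_eq_one_or (Equiv.Perm.sign σ) with h | h <;> rw [h] <;> simp
        rw [h1]
        refine (f.le_opNorm _).trans_eq ?_
        congr 1
        exact Equiv.prod_comp σ (fun i => ‖v i‖)
      refine (Finset.sum_le_card_nsmul _ _ _ this).trans_eq ?_
      simp [Fintype.card_perm, mul_assoc])

theorem altCLM_coe (f : E [⋀^Fin k]→L[ℝ] ℂ) :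
    altCLM E k f.toContinuousMultilinearMap = (Nat.factorial k : ℝ) • f := by
  ext v
  have : ∀ σ : Equiv.Perm (Fin k), Equiv.Perm.sign σ • f (v ∘ σ) = f v := by
    intro σ
    have := f.toAlternatingMap.map_perm v σ
    simp only [ContinuousAlternatingMap.coe_toAlternatingMap] at this
    rw [this, smul_smul]
    simp
  simp only [altCLM, LinearMap.mkContinuous_apply, LinearMap.coe_mk, AddHom.coe_mk,
    ContinuousMultilinearMap.alternatization_apply_apply,
    ContinuousAlternatingMap.coe_toContinuousMultilinearMap, this]
  simp [Fintype.card_perm]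

/-- The pull-back of an alternating map along a linear map depends smoothly on both of them. -/
theorem contDiff_comp_alternating :
    ContDiff ℝ ∞ (fun p : (F [⋀^Fin k]→L[ℝ] ℂ) × (E →L[ℝ] F) =>
      p.1.compContinuousLinearMap p.2) := by
  have h1 : ContDiff ℝ ∞ (fun p : (F [⋀^Fin k]→L[ℝ] ℂ) × (E →L[ℝ] F) =>
      (ContinuousMultilinearMap.compContinuousLinearMapContinuousMultilinear ℝ
        (fun _ : Fin k => E) (fun _ => F) ℂ (fun _ => p.2))
        (ContinuousAlternatingMap.toContinuousMultilinearMapCLM ℝ p.1)) := by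
    refine ContDiff.clm_apply ?_ ?_
    · exact (ContinuousMultilinearMap.contDiff _).comp
        (contDiff_pi.2 fun _ => contDiff_snd)
    · exact (ContinuousLinearMap.contDiff _).comp contDiff_fst
  have h2 := ((altCLM E k).contDiff (n := ∞)).comp h1
  have h3 := h2.const_smul ((Nat.factorial k : ℝ)⁻¹)
  convert h3 using 1
  ext1 p
  have : (altCLM E k) (p.1.compContinuousLinearMap p.2).toContinuousMultilinearMap
    = (Nat.factorial k : ℝ) • (p.1.compContinuousLinearMap p.2) := altCLM_coe _
  have h0 : (Nat.factorial k : ℝ) ≠ 0 := by positivity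
  rw [← inv_smul_smul₀ h0 (p.1.compContinuousLinearMap p.2), ← this]
  rfl

end Alternating

/-! ### Differential forms on manifolds -/
section Forms
variable {E M : Type*} [NormedAddCommGroup E] [NormedSpace ℝ E]
  [TopologicalSpace M] [ChartedSpace E M]
  {E' N : Type*} [NormedAddCommGroup E'] [NormedSpace ℝ E']
  [TopologicalSpace N] [ChartedSpace E' N] {k : ℕ}

variable (E M k) in
/-- Not necessarily smooth `ℂ`-valued forms of degree `k` on a manifold `M` modelled on `E`: an
alternating continuous `k`-linear form on each tangent space. The tangent space
`TangentSpace 𝓘(ℝ, E) x` is by definition `E`, identified through the preferred chart at `x`. -/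
abbrev RawForm : Type _ := M → E [⋀^Fin k]→L[ℝ] ℂ

/-- The expression of a form in the chart at `x₀`, i.e. its pull-back by the inverse chart. -/
def chartRep (α : RawForm E M k) (x₀ : M) : E → E [⋀^Fin k]→L[ℝ] ℂ := fun y =>
  (α ((extChartAt 𝓘(ℝ, E) x₀).symm y)).compContinuousLinearMap
    (mfderiv 𝓘(ℝ, E) 𝓘(ℝ, E) (extChartAt 𝓘(ℝ, E) x₀).symm y)

open Classical in
/-- Replace a form by zero outside of `U`. -/
def cut (U : Opens M) : RawForm E M k →ₗ[ℂ] RawForm E M k where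
  toFun α x := if x ∈ U then α x else 0
  map_add' α η := by ext1 x; by_cases h : x ∈ U <;> simp [h]
  map_smul' c α := by
    ext1 x
    by_cases h : x ∈ U
    · simp [h]
    · simp only [Pi.smul_apply, h, if_false, RingHom.id_apply]
      exact (smul_zero (A := E [⋀^Fin k]→L[ℝ] ℂ) c).symm

/-- Pull-back of a form by a map. -/
def rawPullback (f : N → M) : RawForm E M k →ₗ[ℂ] RawForm E' N k where
  toFun α x := (α (f x)).compContinuousLinearMap (mfderiv 𝓘(ℝ, E') 𝓘(ℝ, E) f x)
  map_add' α η := by ext x; rfl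
  map_smul' c α := by ext x; rfl

/-- Exterior derivative, computed at each point in the chart at that point. -/
def rawD (α : RawForm E M k) : RawForm E M (k + 1) := fun x =>
  (extDeriv (chartRep α x) (extChartAt 𝓘(ℝ, E) x x)).compContinuousLinearMap
    (mfderiv 𝓘(ℝ, E) 𝓘(ℝ, E) (extChartAt 𝓘(ℝ, E) x) x)

/-- The part of the target of the chart at `x₀` that corresponds to points of `U`. -/
def chartDom (E : Type*) [NormedAddCommGroup E] [NormedSpace ℝ E] {M : Type*} [TopologicalSpace M]
    [ChartedSpace E M] (U : Opens M) (x₀ : M) : Set E :=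
  (extChartAt 𝓘(ℝ, E) x₀).target ∩ (extChartAt 𝓘(ℝ, E) x₀).symm ⁻¹' U

/-- A form is smooth on `U` if its expressions in the charts are smooth. -/
def SmoothOn (U : Opens M) (α : RawForm E M k) : Prop :=
  ∀ x₀ : M, ContDiffOn ℝ ∞ (chartRep α x₀) (chartDom E U x₀)

theorem isOpen_chartDom (U : Opens M) (x₀ : M) : IsOpen (chartDom E U x₀) :=
  (continuousOn_extChartAt_symm x₀).isOpen_inter_preimage (isOpen_extChartAt_target x₀) U.2

theorem chartRep_add (α η : RawForm E M k) (x₀ : M) :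
   chartRep (α + η) x₀ = chartRep α x₀ + chartRep η x₀ := rfl
theorem chartRep_smul (c : ℂ) (α : RawForm E M k) (x₀ : M) :
   chartRep (c • α) x₀ = c • chartRep α x₀ := rfl
theorem chartRep_congr {U : Opens M} {α η : RawForm E M k} (h : ∀ x ∈ U, α x = η x) (x₀ : M) :
    EqOn (chartRep α x₀) (chartRep η x₀) (chartDom E U x₀) := by
  intro y hy
  simp only [chartRep]
  rw [h _ hy.2]
theorem SmoothOn.congr {U : Opens M} {α η : RawForm E M k} (hα : SmoothOn U α)
    (h : ∀ x ∈ U, α x = η x) : SmoothOn U η := fun x₀ =>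
  (hα x₀).congr (chartRep_congr (fun x hx => (h x hx).symm) x₀)
theorem SmoothOn.mono {U W : Opens M} {α : RawForm E M k} (hα : SmoothOn U α)
    (h : W ≤ U) : SmoothOn W α := fun x₀ =>
  (hα x₀).mono (inter_subset_inter_right _ (preimage_mono h))


theorem cut_of_mem {U : Opens M} {x : M} (α : RawForm E M k) (h : x ∈ U) : cut U α x = α x :=
  if_pos h
theorem cut_of_notMem {U : Opens M} {x : M} (α : RawForm E M k) (h : x ∉ U) : cut U α x = 0 :=
  if_neg h

variable (E) in
/-- The smooth `k`-forms on the open set `U`. A form on `U` is extended by zero to the points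
outside of `U`, so that it is determined by its values on `U`. -/
def formSubmodule (U : Opens M) (k : ℕ) : Submodule ℂ (RawForm E M k) where
  carrier := {α | (∀ x ∉ U, α x = 0) ∧ SmoothOn U α}
  add_mem' := fun {α η} hα hη => ⟨fun x hx => by simp [hα.1 x hx, hη.1 x hx], fun x₀ =>
    (hα.2 x₀).add (hη.2 x₀)⟩
  zero_mem' := ⟨fun _ _ => rfl, fun x₀ => by
    have : chartRep (0 : RawForm E M k) x₀ = fun _ => 0 := rfl
    rw [this]; exact contDiffOn_const⟩
  smul_mem' := fun c α hα => ⟨fun x hx => by simp [hα.1 x hx], fun x₀ =>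
    (hα.2 x₀).const_smul c⟩


variable (E) in
/-- The space `Ω^k(U)` of smooth `ℂ`-valued `k`-forms on the open set `U`. -/
def Form (U : Opens M) (k : ℕ) : Type _ := ↥(formSubmodule E U k)

instance (U : Opens M) (k : ℕ) : AddCommGroup (Form E U k) :=
  inferInstanceAs (AddCommGroup ↥(formSubmodule E U k))

instance (U : Opens M) (k : ℕ) : Module ℂ (Form E U k) :=
  inferInstanceAs (Module ℂ ↥(formSubmodule E U k))

theorem two_le_infty : minSmoothness ℝ 2 ≤ (∞ : WithTop ℕ∞) := by
  rw [minSmoothness_of_isRCLikeNormedField]; exact ENat.LEInfty.out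

/-! ### Smoothness of exterior derivatives and pull-backs -/
section Local
variable [IsManifold 𝓘(ℝ, E) ∞ M] [IsManifold 𝓘(ℝ, E') ∞ N]

/-- The coordinate expression of a map. -/
def coordMap (E E' : Type*) [NormedAddCommGroup E] [NormedSpace ℝ E] [NormedAddCommGroup E']
    [NormedSpace ℝ E'] {M N : Type*} [TopologicalSpace M] [ChartedSpace E M]
    [TopologicalSpace N] [ChartedSpace E' N] (f : N → M) (x₀ : N) (z₀ : M) : E' → E :=
  extChartAt 𝓘(ℝ, E) z₀ ∘ f ∘ (extChartAt 𝓘(ℝ, E') x₀).symm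

theorem contMDiffAt_symm (x₀ : M) {y : E} (hy : y ∈ (extChartAt 𝓘(ℝ, E) x₀).target) :
    ContMDiffAt 𝓘(ℝ, E) 𝓘(ℝ, E) ∞ (extChartAt 𝓘(ℝ, E) x₀).symm y :=
  (contMDiffOn_extChartAt_symm x₀).contMDiffAt ((isOpen_extChartAt_target x₀).mem_nhds hy)

theorem contDiffAt_coordMap {f : N → M} (hf : ContMDiff 𝓘(ℝ, E') 𝓘(ℝ, E) ∞ f) (x₀ : N) (z₀ : M)
    {y : E'} (hy : y ∈ (extChartAt 𝓘(ℝ, E') x₀).target)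
    (hz : f ((extChartAt 𝓘(ℝ, E') x₀).symm y) ∈ (extChartAt 𝓘(ℝ, E) z₀).source) :
    ContDiffAt ℝ ∞ (coordMap E E' f x₀ z₀) y := by
  rw [← contMDiffAt_iff_contDiffAt]
  rw [extChartAt_source] at hz
  exact (contMDiffAt_extChartAt' hz).comp y (hf.contMDiffAt.comp y (contMDiffAt_symm x₀ hy))

theorem eventually_coord {f : N → M} (hf : Continuous f) (x₀ : N) (z₀ : M)
    {y : E'} (hy : y ∈ (extChartAt 𝓘(ℝ, E') x₀).target)
    (hz : f ((extChartAt 𝓘(ℝ, E') x₀).symm y) ∈ (extChartAt 𝓘(ℝ, E) z₀).source) :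
    ∀ᶠ y' in 𝓝 y, y' ∈ (extChartAt 𝓘(ℝ, E') x₀).target ∧
      f ((extChartAt 𝓘(ℝ, E') x₀).symm y') ∈ (extChartAt 𝓘(ℝ, E) z₀).source := by
  refine ((isOpen_extChartAt_target x₀).eventually_mem hy).and ?_
  have h1 : ContinuousAt (f ∘ (extChartAt 𝓘(ℝ, E') x₀).symm) y :=
    hf.continuousAt.comp (continuousAt_extChartAt_symm'' hy)
  exact h1.eventually ((isOpen_extChartAt_source z₀).eventually_mem hz)

theorem chartRep_rawPullback {f : N → M} (hf : ContMDiff 𝓘(ℝ, E') 𝓘(ℝ, E) ∞ f)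
    (α : RawForm E M k) (x₀ : N) (z₀ : M)
    {y : E'} (hy : y ∈ (extChartAt 𝓘(ℝ, E') x₀).target)
    (hz : f ((extChartAt 𝓘(ℝ, E') x₀).symm y) ∈ (extChartAt 𝓘(ℝ, E) z₀).source) :
    chartRep (rawPullback f α) x₀ y =
      (chartRep α z₀ (coordMap E E' f x₀ z₀ y)).compContinuousLinearMap
        (fderiv ℝ (coordMap E E' f x₀ z₀) y) := by
  have hback : (extChartAt 𝓘(ℝ, E) z₀).symm (coordMap E E' f x₀ z₀ y)
      = f ((extChartAt 𝓘(ℝ, E') x₀).symm y) := (extChartAt 𝓘(ℝ, E) z₀).left_inv hz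
  have hgt : coordMap E E' f x₀ z₀ y ∈ (extChartAt 𝓘(ℝ, E) z₀).target :=
    (extChartAt 𝓘(ℝ, E) z₀).map_source hz
  have hψ := (contMDiffAt_symm x₀ hy).mdifferentiableAt (by simp)
  have hφ := (contMDiffAt_symm z₀ hgt).mdifferentiableAt (by simp)
  have hg := ((contDiffAt_coordMap hf x₀ z₀ hy hz).contMDiffAt).mdifferentiableAt (by simp)
  have hff := (hf.contMDiffAt (x := (extChartAt 𝓘(ℝ, E') x₀).symm y)).mdifferentiableAt (by simp)
  have e1 := mfderiv_comp y hff hψ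
  have e2 := mfderiv_comp y hφ hg
  have e3 : f ∘ (extChartAt 𝓘(ℝ, E') x₀).symm =ᶠ[𝓝 y]
      (extChartAt 𝓘(ℝ, E) z₀).symm ∘ coordMap E E' f x₀ z₀ := by
    filter_upwards [eventually_coord hf.continuous x₀ z₀ hy hz] with y' hy'
    exact ((extChartAt 𝓘(ℝ, E) z₀).left_inv hy'.2).symm
  have e4 := e3.mfderiv_eq (I := 𝓘(ℝ, E')) (I' := 𝓘(ℝ, E))
  ext v
  have key : ∀ u : E', (mfderiv 𝓘(ℝ, E') 𝓘(ℝ, E) f ((extChartAt 𝓘(ℝ, E') x₀).symm y)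
      (mfderiv 𝓘(ℝ, E') 𝓘(ℝ, E') (extChartAt 𝓘(ℝ, E') x₀).symm y u) : E) =
      mfderiv 𝓘(ℝ, E) 𝓘(ℝ, E) (extChartAt 𝓘(ℝ, E) z₀).symm (coordMap E E' f x₀ z₀ y)
        (fderiv ℝ (coordMap E E' f x₀ z₀) y u) := by
    intro u
    have h1 := DFunLike.congr_fun e1 u
    have h2 := DFunLike.congr_fun e2 u
    rw [mfderiv_eq_fderiv] at h2
    refine h1.symm.trans (Eq.trans ?_ h2)
    exact DFunLike.congr_fun e4 u
  have hα : ∀ p q : M, p = q → ∀ w : Fin k → E, (α p : E [⋀^Fin k]→L[ℝ] ℂ) w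
      = (α q : E [⋀^Fin k]→L[ℝ] ℂ) w := by rintro p q rfl w; rfl
  refine Eq.trans ?_ (hα _ _ hback.symm _)
  exact congrArg (fun w => (α (f ((extChartAt 𝓘(ℝ, E') x₀).symm y)) : E [⋀^Fin k]→L[ℝ] ℂ) w)
    (funext fun i => key (v i))

theorem rawPullback_id (α : RawForm E M k) : rawPullback (id : M → M) α = α := by
  ext x v
  have : mfderiv 𝓘(ℝ, E) 𝓘(ℝ, E) (id : M → M) x = ContinuousLinearMap.id ℝ _ := mfderiv_id
  simp only [rawPullback, LinearMap.coe_mk, AddHom.coe_mk]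
  rw [this]; rfl

theorem smoothOn_rawPullback {f : N → M} (hf : ContMDiff 𝓘(ℝ, E') 𝓘(ℝ, E) ∞ f)
    {U : Opens M} {W : Opens N} (h : MapsTo f W U) {α : RawForm E M k} (hα : SmoothOn U α) :
    SmoothOn W (rawPullback f α : RawForm E' N k) := by
  intro x₀ y hy
  refine ContDiffAt.contDiffWithinAt ?_
  set z₀ := f ((extChartAt 𝓘(ℝ, E') x₀).symm y)
  have hz : f ((extChartAt 𝓘(ℝ, E') x₀).symm y) ∈ (extChartAt 𝓘(ℝ, E) z₀).source :=
    mem_extChartAt_source _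
  have hg := contDiffAt_coordMap hf x₀ z₀ hy.1 hz
  have hback : (extChartAt 𝓘(ℝ, E) z₀).symm (coordMap E E' f x₀ z₀ y)
      = f ((extChartAt 𝓘(ℝ, E') x₀).symm y) := (extChartAt 𝓘(ℝ, E) z₀).left_inv hz
  have hgd : coordMap E E' f x₀ z₀ y ∈ chartDom E U z₀ := by
    refine ⟨(extChartAt 𝓘(ℝ, E) z₀).map_source hz, ?_⟩
    rw [mem_preimage, hback]; exact h hy.2
  have h1 : ContDiffAt ℝ ∞ (chartRep α z₀) (coordMap E E' f x₀ z₀ y) :=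
    (hα z₀).contDiffAt ((isOpen_chartDom U z₀).mem_nhds hgd)
  have h2 := contDiff_comp_alternating.contDiffAt.comp y
    ((h1.comp y hg).prodMk (hg.fderiv_right (m := ∞) (by simp)))
  refine h2.congr_of_eventuallyEq ?_
  filter_upwards [eventually_coord hf.continuous x₀ z₀ hy.1 hz] with y' hy'
  exact chartRep_rawPullback hf α x₀ z₀ hy'.1 hy'.2

theorem comp_comp_alternating {A B C : Type*} [NormedAddCommGroup A] [NormedSpace ℝ A]
    [NormedAddCommGroup B] [NormedSpace ℝ B] [NormedAddCommGroup C] [NormedSpace ℝ C]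
    (a : C [⋀^Fin k]→L[ℝ] ℂ) (g : B →L[ℝ] C) (h : A →L[ℝ] B) :
    (a.compContinuousLinearMap g).compContinuousLinearMap h
      = a.compContinuousLinearMap (g ∘L h) := rfl

/-- The exterior derivative can be computed in any chart. -/
theorem chartRep_rawD {U : Opens M} {α : RawForm E M k} (hα : SmoothOn U α) (z₀ : M) :
    EqOn (chartRep (rawD α) z₀) (extDeriv (chartRep α z₀)) (chartDom E U z₀) := by
  intro y hy
  set x := (extChartAt 𝓘(ℝ, E) z₀).symm y with hx
  have hxs : x ∈ (extChartAt 𝓘(ℝ, E) x).source := mem_extChartAt_source _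
  have hid : ContMDiff 𝓘(ℝ, E) 𝓘(ℝ, E) ∞ (id : M → M) := contMDiff_id
  have hg := contDiffAt_coordMap hid z₀ x hy.1 hxs
  have hgy : coordMap E E (id : M → M) z₀ x y = extChartAt 𝓘(ℝ, E) x x := rfl
  have hgd : extChartAt 𝓘(ℝ, E) x x ∈ chartDom E U x := by
    refine ⟨mem_extChartAt_target x, ?_⟩
    rw [mem_preimage, extChartAt_to_inv]; exact hy.2
  have h1 : ContDiffAt ℝ ∞ (chartRep α x) (coordMap E E (id : M → M) z₀ x y) := by
    rw [hgy]; exact (hα x).contDiffAt ((isOpen_chartDom U x).mem_nhds hgd)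
  have h2 : chartRep α z₀ =ᶠ[𝓝 y] fun y' =>
      (chartRep α x (coordMap E E (id : M → M) z₀ x y')).compContinuousLinearMap
        (fderiv ℝ (coordMap E E (id : M → M) z₀ x) y') := by
    filter_upwards [eventually_coord continuous_id z₀ x hy.1 hxs] with y' hy'
    have := chartRep_rawPullback hid α z₀ x hy'.1 hy'.2
    rwa [rawPullback_id] at this
  rw [h2.extDeriv_eq, extDeriv_pullback (h1.differentiableAt (by simp)) hg two_le_infty]
  have e1 := mfderiv_comp y
    ((contMDiffAt_extChartAt (I := 𝓘(ℝ, E)) (n := ∞) (x := x)).mdifferentiableAt (by simp))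
    ((contMDiffAt_symm z₀ hy.1).mdifferentiableAt (by simp))
  rw [mfderiv_eq_fderiv] at e1
  change ((extDeriv (chartRep α x) (extChartAt 𝓘(ℝ, E) x x)).compContinuousLinearMap
    (mfderiv 𝓘(ℝ, E) 𝓘(ℝ, E) (extChartAt 𝓘(ℝ, E) x) x)).compContinuousLinearMap
    (mfderiv 𝓘(ℝ, E) 𝓘(ℝ, E) (extChartAt 𝓘(ℝ, E) z₀).symm y) = _
  ext v
  refine congrArg (extDeriv (chartRep α x) (extChartAt 𝓘(ℝ, E) x x)) (funext fun i => ?_)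
  exact (DFunLike.congr_fun e1 (v i)).symm

theorem smoothOn_rawD {U : Opens M} {α : RawForm E M k} (hα : SmoothOn U α) :
    SmoothOn U (rawD α) := by
  intro z₀
  refine ContDiffOn.congr ?_ (chartRep_rawD hα z₀)
  intro y hy
  have h1 : ContDiffAt ℝ ∞ (chartRep α z₀) y :=
    (hα z₀).contDiffAt ((isOpen_chartDom U z₀).mem_nhds hy)
  exact ((ContinuousAlternatingMap.alternatizeUncurryFinCLM ℝ E ℂ).contDiff.contDiffAt.comp y
    (h1.fderiv_right (m := ∞) (by simp))).contDiffWithinAt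

theorem mem_chartDom_self {U : Opens M} {x : M} (hx : x ∈ U) :
    extChartAt 𝓘(ℝ, E) x x ∈ chartDom E U x :=
  ⟨mem_extChartAt_target x, by rw [mem_preimage, extChartAt_to_inv]; exact hx⟩

theorem rawD_congr {U : Opens M} {α β : RawForm E M k} (h : ∀ x ∈ U, α x = β x) {x : M}
    (hx : x ∈ U) : rawD α x = rawD β x := by
  have : chartRep α x =ᶠ[𝓝 (extChartAt 𝓘(ℝ, E) x x)] chartRep β x :=
    Filter.eventually_of_mem ((isOpen_chartDom U x).mem_nhds (mem_chartDom_self hx))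
      (chartRep_congr h x)
  simp only [rawD, this.extDeriv_eq]

/-- Two forms agree at a point if they agree in a chart at that point. -/
theorem eq_of_chartRep {α β : RawForm E M k} {x : M}
    (h : chartRep α x (extChartAt 𝓘(ℝ, E) x x) = chartRep β x (extChartAt 𝓘(ℝ, E) x x)) :
    α x = β x := by
  have key : ∀ γ : RawForm E M k, ∀ v : Fin k → E, (γ x : E [⋀^Fin k]→L[ℝ] ℂ) v =
      chartRep γ x (extChartAt 𝓘(ℝ, E) x x)
        (fun i => mfderiv 𝓘(ℝ, E) 𝓘(ℝ, E) (extChartAt 𝓘(ℝ, E) x) x (v i)) := by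
    intro γ v
    have e1 := mfderiv_comp x
      ((contMDiffAt_symm x (mem_extChartAt_target x)).mdifferentiableAt (by simp))
      ((contMDiffAt_extChartAt (I := 𝓘(ℝ, E)) (n := ∞) (x := x)).mdifferentiableAt (by simp))
    have e2 : (extChartAt 𝓘(ℝ, E) x).symm ∘ extChartAt 𝓘(ℝ, E) x =ᶠ[𝓝 x] id := by
      filter_upwards [extChartAt_source_mem_nhds (I := 𝓘(ℝ, E)) x] with z hz
      exact (extChartAt 𝓘(ℝ, E) x).left_inv hz
    have e3 := e2.mfderiv_eq (I := 𝓘(ℝ, E)) (I' := 𝓘(ℝ, E))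
    have hγ : ∀ p q : M, p = q → ∀ w : Fin k → E, (γ p : E [⋀^Fin k]→L[ℝ] ℂ) w
      = (γ q : E [⋀^Fin k]→L[ℝ] ℂ) w := by rintro p q rfl w; rfl
    refine Eq.trans ?_ (hγ _ _ (extChartAt_to_inv x).symm _)
    refine congrArg (γ x : E [⋀^Fin k]→L[ℝ] ℂ) (funext fun i => ?_)
    have h1 := DFunLike.congr_fun e1 (v i)
    have h2 := DFunLike.congr_fun e3 (v i)
    have h3 : (mfderiv 𝓘(ℝ, E) 𝓘(ℝ, E) (id : M → M) x) (v i) = v i := by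
      rw [mfderiv_id]; rfl
    exact h3.symm.trans (h2.symm.trans h1)
  ext v
  exact (key α v).trans ((DFunLike.congr_fun h _).trans (key β v).symm)

/-- The exterior derivative commutes with pull-backs. -/
theorem rawD_rawPullback {f : N → M} (hf : ContMDiff 𝓘(ℝ, E') 𝓘(ℝ, E) ∞ f) {U : Opens M}
    {α : RawForm E M k} (hα : SmoothOn U α) {x : N} (hx : f x ∈ U) :
    rawD (rawPullback f α : RawForm E' N k) x = rawPullback f (rawD α) x := by
  apply eq_of_chartRep
  let W : Opens N := ⟨f ⁻¹' U, U.2.preimage hf.continuous⟩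
  have hW : SmoothOn W (rawPullback f α : RawForm E' N k) := smoothOn_rawPullback hf (fun _ h => h) hα
  have hxs : f ((extChartAt 𝓘(ℝ, E') x).symm (extChartAt 𝓘(ℝ, E') x x)) ∈
      (extChartAt 𝓘(ℝ, E) (f x)).source := by
    rw [extChartAt_to_inv]; exact mem_extChartAt_source _
  have hy := mem_extChartAt_target (I := 𝓘(ℝ, E')) x
  have hg := contDiffAt_coordMap hf x (f x) hy hxs
  have hgy : coordMap E E' f x (f x) (extChartAt 𝓘(ℝ, E') x x)
      = extChartAt 𝓘(ℝ, E) (f x) (f x) := by simp [coordMap]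
  have h1 : ContDiffAt ℝ ∞ (chartRep α (f x))
      (coordMap E E' f x (f x) (extChartAt 𝓘(ℝ, E') x x)) := by
    rw [hgy]
    exact (hα (f x)).contDiffAt ((isOpen_chartDom U (f x)).mem_nhds (mem_chartDom_self hx))
  rw [chartRep_rawD hW x (mem_chartDom_self (U := W) hx), chartRep_rawPullback hf _ x (f x) hy hxs]
  have h2 : chartRep (rawPullback f α : RawForm E' N k) x =ᶠ[𝓝 (extChartAt 𝓘(ℝ, E') x x)] fun y' =>
      (chartRep α (f x) (coordMap E E' f x (f x) y')).compContinuousLinearMap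
        (fderiv ℝ (coordMap E E' f x (f x)) y') := by
    filter_upwards [eventually_coord hf.continuous x (f x) hy hxs] with y' hy'
    exact chartRep_rawPullback hf α x (f x) hy'.1 hy'.2
  rw [h2.extDeriv_eq, extDeriv_pullback (h1.differentiableAt (by simp)) hg two_le_infty,
    chartRep_rawD hα (f x)]
  rw [hgy]; exact mem_chartDom_self hx

theorem rawD_add {U : Opens M} {α β : RawForm E M k} (hα : SmoothOn U α) (hβ : SmoothOn U β)
    {x : M} (hx : x ∈ U) : rawD (α + β) x = rawD α x + rawD β x := by
  have h : ∀ {γ : RawForm E M k}, SmoothOn U γ →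
      DifferentiableAt ℝ (chartRep γ x) (extChartAt 𝓘(ℝ, E) x x) := fun {γ} hγ =>
    ((hγ x).contDiffAt ((isOpen_chartDom U x).mem_nhds (mem_chartDom_self hx))).differentiableAt
      (by simp)
  simp only [rawD]
  rw [chartRep_add, extDeriv_add (h hα) (h hβ)]
  rfl

theorem rawD_smul {U : Opens M} (c : ℂ) {α : RawForm E M k} (hα : SmoothOn U α)
    {x : M} (hx : x ∈ U) : rawD (c • α) x = c • rawD α x := by
  have h : DifferentiableAt ℝ (chartRep α x) (extChartAt 𝓘(ℝ, E) x x) :=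
    ((hα x).contDiffAt ((isOpen_chartDom U x).mem_nhds (mem_chartDom_self hx))).differentiableAt
      (by simp)
  have h2 : extDeriv (c • chartRep α x) (extChartAt 𝓘(ℝ, E) x x)
      = c • extDeriv (chartRep α x) (extChartAt 𝓘(ℝ, E) x x) := by
    ext v
    have h' : DifferentiableAt ℝ (c • chartRep α x) (extChartAt 𝓘(ℝ, E) x x) := h.const_smul c
    rw [extDeriv_apply h', ContinuousAlternatingMap.smul_apply, extDeriv_apply h, Finset.smul_sum]
    refine Finset.sum_congr rfl fun i _ => ?_
    have h3 : DifferentiableAt ℝ (fun y => chartRep α x y (i.removeNth v))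
      (extChartAt 𝓘(ℝ, E) x x) := by
      fun_prop
    have := fderiv_const_smul h3 c
    rw [show (fun y => (c • chartRep α x) y (i.removeNth v))
      = c • (fun y => chartRep α x y (i.removeNth v)) from rfl, this]
    simp only [_root_.smul_apply]
    rw [smul_comm]
  simp only [rawD]
  rw [chartRep_smul, h2]
  rfl

end Local

/-! ### The maps between the groups of smooth forms -/
section Maps
variable [IsManifold 𝓘(ℝ, E) ∞ M] [IsManifold 𝓘(ℝ, E') ∞ N]

/-- The exterior derivative `d : Ω^k(U) → Ω^{k+1}(U)`. -/
def extD (U : Opens M) (k : ℕ) : Form E U k →ₗ[ℂ] Form E U (k + 1) where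
  toFun α := ⟨cut U (rawD α.1), fun _ hx => cut_of_notMem _ hx,
    (smoothOn_rawD α.2.2).congr fun _ hx => (cut_of_mem _ hx).symm⟩
  map_add' α β := by
    apply Subtype.ext
    funext x
    by_cases hx : x ∈ U
    · exact (cut_of_mem _ hx).trans ((rawD_add α.2.2 β.2.2 hx).trans
        (congrArg₂ (· + ·) (cut_of_mem _ hx).symm (cut_of_mem _ hx).symm))
    · exact (cut_of_notMem _ hx).trans ((add_zero _).symm.trans
        (congrArg₂ (· + ·) (cut_of_notMem _ hx).symm (cut_of_notMem _ hx).symm))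
  map_smul' c α := by
    apply Subtype.ext
    funext x
    by_cases hx : x ∈ U
    · exact (cut_of_mem _ hx).trans ((rawD_smul c α.2.2 hx).trans
        (congrArg (c • ·) (cut_of_mem _ hx).symm))
    · exact (cut_of_notMem _ hx).trans ((smul_zero c).symm.trans
        (congrArg (c • ·) (cut_of_notMem _ hx).symm))

/-- Restriction of forms to a smaller open set. -/
def restrictForm {U W : Opens M} (h : W ≤ U) (k : ℕ) : Form E U k →ₗ[ℂ] Form E W k :=
  ((cut W).domRestrict (formSubmodule E U k)).codRestrict (formSubmodule E W k) fun α =>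
    ⟨fun _ hx => cut_of_notMem _ hx,
      (α.2.2.mono h).congr fun _ hx => (cut_of_mem _ hx).symm⟩

/-- The pull-back `f^* : Ω^k(U) → Ω^k(W)` along a smooth map `f` that maps `W` into `U`. -/
def pullbackForm (f : C^∞⟮𝓘(ℝ, E'), N; 𝓘(ℝ, E), M⟯) {U : Opens M} {W : Opens N}
    (h : MapsTo f W U) (k : ℕ) : Form E U k →ₗ[ℂ] Form E' W k :=
  ((cut W ∘ₗ rawPullback f).domRestrict (formSubmodule E U k)).codRestrict (formSubmodule E' W k) fun α =>
    ⟨fun _ hx => cut_of_notMem _ hx,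
      (smoothOn_rawPullback f.contMDiff h α.2.2).congr fun _ hx => (cut_of_mem _ hx).symm⟩

theorem extD_restrictForm {U W : Opens M} (h : W ≤ U) (k : ℕ) (α : Form E U k) :
    extD W k (restrictForm h k α) = restrictForm h (k + 1) (extD U k α) := by
  apply Subtype.ext
  funext x
  by_cases hx : x ∈ W
  · refine (cut_of_mem _ hx).trans (Eq.trans ?_ (cut_of_mem _ hx).symm)
    exact (rawD_congr (fun y hy => cut_of_mem _ hy) hx).trans (cut_of_mem _ (h hx)).symm
  · exact (cut_of_notMem _ hx).trans (cut_of_notMem _ hx).symm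

theorem extD_pullbackForm (f : C^∞⟮𝓘(ℝ, E'), N; 𝓘(ℝ, E), M⟯) {U : Opens M} {W : Opens N}
    (h : MapsTo f W U) (k : ℕ) (α : Form E U k) :
    extD W k (pullbackForm f h k α) = pullbackForm f h (k + 1) (extD U k α) := by
  apply Subtype.ext
  funext x
  by_cases hx : x ∈ W
  · refine (cut_of_mem _ hx).trans (Eq.trans ?_ (cut_of_mem _ hx).symm)
    refine (rawD_congr (fun y hy => cut_of_mem _ hy) hx).trans ?_
    refine (rawD_rawPullback f.contMDiff α.2.2 (h hx)).trans ?_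
    have : rawD α.1 (f x) = (extD U k α).1 (f x) := (cut_of_mem _ (h hx)).symm
    simp only [rawPullback, LinearMap.coe_mk, AddHom.coe_mk, this]
    rfl
  · exact (cut_of_notMem _ hx).trans (cut_of_notMem _ hx).symm

end Maps
end Forms

/-! ### Cohomology of a sequence of linear maps -/
section Cohomology
variable {C : ℕ → Type*} [∀ n, AddCommGroup (C n)] [∀ n, Module ℂ (C n)]

/-- The coboundaries: the image of the preceding map (zero in degree `0`). -/
def coboundaries (d : ∀ n, C n →ₗ[ℂ] C (n + 1)) : ∀ n, Submodule ℂ (C n)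
  | 0 => ⊥
  | n + 1 => LinearMap.range (d n)

/-- The cohomology in degree `n`: cocycles modulo coboundaries. -/
abbrev Cohomology (d : ∀ n, C n →ₗ[ℂ] C (n + 1)) (n : ℕ) : Type _ :=
  LinearMap.ker (d n) ⧸ (coboundaries d n).submoduleOf (LinearMap.ker (d n))

/-- The cohomology class of a cocycle. -/
def cls (d : ∀ n, C n →ₗ[ℂ] C (n + 1)) (n : ℕ) (z : C n) (hz : d n z = 0) : Cohomology d n :=
  Submodule.Quotient.mk ⟨z, hz⟩

end Cohomology

/-! ### The Čech-de Rham complex of an open covering -/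
section Cech
variable {E B Λ : Type*} [NormedAddCommGroup E] [NormedSpace ℝ E]
  [TopologicalSpace B] [ChartedSpace E B] [LinearOrder Λ]

/-- The intersection `U_{λ₀} ∩ … ∩ U_{λₚ}` for `λ₀ < … < λₚ`. -/
def interU (U : Λ → Opens B) {p : ℕ} (s : Fin (p + 1) ↪o Λ) : Opens B :=
  ⟨⋂ i, U (s i), isOpen_iInter_of_finite fun i => (U (s i)).2⟩

theorem interU_le (U : Λ → Opens B) {p : ℕ} (s : Fin (p + 1) ↪o Λ) (i : Fin (p + 1)) :
    interU U s ≤ U (s i) := iInter_subset _ i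

/-- The tuple `s` with its `i`-th entry left out. -/
def face {p : ℕ} (s : Fin (p + 2) ↪o Λ) (i : Fin (p + 2)) : Fin (p + 1) ↪o Λ :=
  (Fin.succAboveOrderEmb i).trans s

theorem interU_le_face (U : Λ → Opens B) {p : ℕ} (s : Fin (p + 2) ↪o Λ) (i : Fin (p + 2)) :
    interU U s ≤ interU U (face s i) :=
  subset_iInter fun j => iInter_subset _ (i.succAbove j)

variable (E) in
/-- Čech-de Rham cochains of bidegree `(p, q)`: a `q`-form on every intersection
`U_{λ₀…λₚ}` with `λ₀ < … < λₚ` (on an empty intersection there is only the form `0`). -/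
abbrev Cochain (U : Λ → Opens B) (p q : ℕ) : Type _ :=
  ∀ s : Fin (p + 1) ↪o Λ, Form E (interU U s) q

/-- The Čech operator `(δω)_{λ₀…λₚ₊₁} = ∑ᵢ (-1)ⁱ ω_{λ₀…λ̂ᵢ…λₚ₊₁}` restricted to
`U_{λ₀…λₚ₊₁}`. -/
def cechδ (U : Λ → Opens B) (p q : ℕ) : Cochain E U p q →ₗ[ℂ] Cochain E U (p + 1) q :=
  LinearMap.pi fun s => ∑ i : Fin (p + 2),
    (-1 : ℂ) ^ (i : ℕ) • (restrictForm (interU_le_face U s i) q ∘ₗ LinearMap.proj (face s i))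

/-- A family of forms `ω_λ` on the sets `U_λ`, regarded as a cochain of bidegree `(0, q)`. -/
def ofFamily (U : Λ → Opens B) (q : ℕ) : (∀ l, Form E (U l) q) →ₗ[ℂ] Cochain E U 0 q :=
  LinearMap.pi fun s => restrictForm (interU_le U s 0) q ∘ₗ LinearMap.proj (s 0)

variable [IsManifold 𝓘(ℝ, E) ∞ B]

/-- The exterior derivative of cochains. -/
def cechD (U : Λ → Opens B) (p q : ℕ) : Cochain E U p q →ₗ[ℂ] Cochain E U p (q + 1) :=
  LinearMap.pi fun s => extD (interU U s) q ∘ₗ LinearMap.proj s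

/-- The component of bidegree `(p, q)` of the operator `δ + (-1)ᵖ d`. -/
def totalDComp (U : Λ → Opens B) :
    ∀ p q : ℕ, (∀ p q : ℕ, Cochain E U p q) →ₗ[ℂ] Cochain E U p q
  | 0, 0 => 0
  | 0, q + 1 => cechD U 0 q ∘ₗ LinearMap.proj q ∘ₗ LinearMap.proj 0
  | p + 1, 0 => cechδ U p 0 ∘ₗ LinearMap.proj 0 ∘ₗ LinearMap.proj p
  | p + 1, q + 1 => cechδ U p (q + 1) ∘ₗ LinearMap.proj (q + 1) ∘ₗ LinearMap.proj p +
      (-1 : ℂ) ^ (p + 1) • (cechD U (p + 1) q ∘ₗ LinearMap.proj q ∘ₗ LinearMap.proj (p + 1))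

variable (E) in
/-- Cochains of total degree `n`: families of cochains of bidegree `(p, q)` with `p + q = n`. -/
def Total (U : Λ → Opens B) (n : ℕ) : Submodule ℂ (∀ p q : ℕ, Cochain E U p q) where
  carrier := {c | ∀ p q, p + q ≠ n → c p q = 0}
  add_mem' := fun {a b} ha hb p q h => by simp [ha p q h, hb p q h]
  zero_mem' := fun _ _ _ => rfl
  smul_mem' := fun c a ha p q h => by simp [ha p q h]

theorem totalDComp_mem (U : Λ → Opens B) (n : ℕ) (c : Total E U n) :
    (fun p q => totalDComp U p q c.1) ∈ Total E U (n + 1) := by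
  intro p q h
  match p, q, h with
  | 0, 0, h => rfl
  | 0, q + 1, h =>
    simp [totalDComp, c.2 0 q (by omega)]
  | p + 1, 0, h =>
    simp [totalDComp, c.2 p 0 (by omega)]
  | p + 1, q + 1, h =>
    simp [totalDComp, c.2 p (q + 1) (by omega), c.2 (p + 1) q (by omega)]

/-- The coboundary operator `δ + (-1)ᵖ d` of the Čech-de Rham complex. -/
def totalD (U : Λ → Opens B) (n : ℕ) : Total E U n →ₗ[ℂ] Total E U (n + 1) :=
  ((LinearMap.pi fun p => LinearMap.pi fun q => totalDComp U p q).domRestrict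
    (Total E U n)).codRestrict (Total E U (n + 1)) (totalDComp_mem U n)

/-- A cochain of bidegree `(p, q)`, regarded as a cochain of total degree `n = p + q`. -/
def single (U : Λ → Opens B) {n : ℕ} (p q : ℕ) (h : p + q = n) :
    Cochain E U p q →ₗ[ℂ] Total E U n :=
  (LinearMap.single ℂ (fun p => ∀ q : ℕ, Cochain E U p q) p ∘ₗ
    LinearMap.single ℂ (fun q => Cochain E U p q) q).codRestrict (Total E U n) fun c p' q' h' => by
      by_cases hp : p' = p
      · subst hp
        have hq : q' ≠ q := by rintro rfl; exact h' h
        simp [hq]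
      · simp [hp]

variable (E) in
/-- The Čech-de Rham cohomology of the covering in degree `n`. -/
abbrev CechDR (U : Λ → Opens B) (n : ℕ) : Type _ := Cohomology (totalD (E := E) U) n

variable (E) in
/-- The part of the Čech-de Rham cohomology that is built up by `q`-forms on the intersections
`U_{λ₀…λₚ}`: the classes of the cocycles that are concentrated in bidegree `(p, q)`. -/
def CechDRPart (U : Λ → Opens B) {n : ℕ} (p q : ℕ) (h : p + q = n) :
    Submodule ℂ (CechDR E U n) :=
  ((LinearMap.range (single (E := E) U p q h)).submoduleOf
    (LinearMap.ker (totalD (E := E) U n))).map (Submodule.mkQ _)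

end Cech

/-! ### Coverings and fibre bundles -/
section Geometry
variable {E B Λ : Type*} [NormedAddCommGroup E] [NormedSpace ℝ E]
  [TopologicalSpace B] [ChartedSpace E B] [LinearOrder Λ]

variable (E) in
/-- The open set `W` is contractible in the category of smooth manifolds: there is a smooth homotopy
from a constant map to the identity of `W`. In finite dimension this agrees with contractibility by
a continuous homotopy, since continuous homotopies can be approximated by smooth ones. -/
def SmoothlyContractible (W : Opens B) : Prop :=
  ∃ b₀ ∈ W, ∃ H : ℝ × B → B,
    ContMDiffOn (𝓘(ℝ, ℝ).prod 𝓘(ℝ, E)) 𝓘(ℝ, E) ∞ H (univ ×ˢ (W : Set B)) ∧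
    (∀ t, ∀ x ∈ W, H (t, x) ∈ W) ∧ (∀ x ∈ W, H (0, x) = b₀) ∧ ∀ x ∈ W, H (1, x) = x

variable (E) in
/-- A good covering: an open covering all of whose non-empty finite intersections are
contractible. -/
def IsGoodCover (U : Λ → Opens B) : Prop :=
  (∀ b, ∃ l, b ∈ U l) ∧
    ∀ (p : ℕ) (s : Fin (p + 1) ↪o Λ), (interU U s : Set B).Nonempty →
      SmoothlyContractible E (interU U s)

/-- `π : N → B` is a smooth fibre bundle with fibre `F`: every point of `B` has an open
neighbourhood over which there is a diffeomorphism to the product with `F`,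
compatible with the projections. -/
def IsSmoothFibreBundle {E' N EF : Type*} [NormedAddCommGroup E'] [NormedSpace ℝ E']
    [TopologicalSpace N] [ChartedSpace E' N] [NormedAddCommGroup EF] [NormedSpace ℝ EF]
    (F : Type*) [TopologicalSpace F] [ChartedSpace EF F]
    (π : C^∞⟮𝓘(ℝ, E'), N; 𝓘(ℝ, E), B⟯) : Prop :=
  ∀ b : B, ∃ e : Bundle.Trivialization F π, b ∈ e.baseSet ∧
    ContMDiffOn 𝓘(ℝ, E') (𝓘(ℝ, E).prod 𝓘(ℝ, EF)) ∞ e e.source ∧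
    ContMDiffOn (𝓘(ℝ, E).prod 𝓘(ℝ, EF)) 𝓘(ℝ, E') ∞ e.toOpenPartialHomeomorph.symm e.target

end Geometry

/-! ### The complexes of a smooth map `π : N → B` -/
section Relative
variable {E B E' N Λ : Type*} [NormedAddCommGroup E] [NormedSpace ℝ E]
  [TopologicalSpace B] [ChartedSpace E B] [IsManifold 𝓘(ℝ, E) ∞ B]
  [NormedAddCommGroup E'] [NormedSpace ℝ E']
  [TopologicalSpace N] [ChartedSpace E' N] [IsManifold 𝓘(ℝ, E') ∞ N]

/-- The group `Ω^k(N → B)`: the quotient of `Ω^k(N)` by the forms `π^*ω`, `ω ∈ Ω^k(B)`. -/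
abbrev RelForm (π : C^∞⟮𝓘(ℝ, E'), N; 𝓘(ℝ, E), B⟯) (k : ℕ) : Type _ :=
  Form E' (⊤ : Opens N) k ⧸
    LinearMap.range (pullbackForm π (U := ⊤) (W := ⊤) (mapsTo_univ _ _) k)

/-- The operator induced by `d` on `Ω^k(N → B)`. -/
def relD (π : C^∞⟮𝓘(ℝ, E'), N; 𝓘(ℝ, E), B⟯) (k : ℕ) :
    RelForm π k →ₗ[ℂ] RelForm π (k + 1) :=
  Submodule.mapQ _ _ (extD ⊤ k) (by
    rintro _ ⟨α, rfl⟩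
    exact ⟨extD ⊤ k α, (extD_pullbackForm π _ k α).symm⟩)

/-- `H^k_dR(N → B)`. -/
abbrev RelCohomology (π : C^∞⟮𝓘(ℝ, E'), N; 𝓘(ℝ, E), B⟯) (k : ℕ) : Type _ :=
  Cohomology (relD π) k

/-- The open set `π⁻¹(U)`. -/
def preim (π : C^∞⟮𝓘(ℝ, E'), N; 𝓘(ℝ, E), B⟯) (U : Opens B) : Opens N :=
  ⟨π ⁻¹' U, U.2.preimage π.contMDiff.continuous⟩

/-- The map that sends a form `ω̂` on `N` and forms `ω_λ` on the `U_λ` to the family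
`ω̃_λ = ω̂ - π^*ω_λ` on the `π⁻¹(U_λ)`. -/
def tildeMap (π : C^∞⟮𝓘(ℝ, E'), N; 𝓘(ℝ, E), B⟯) (U : Λ → Opens B) (k : ℕ) :
    (Form E' (⊤ : Opens N) k × ∀ l, Form E (U l) k) →ₗ[ℂ] ∀ l, Form E' (preim π (U l)) k :=
  LinearMap.pi fun l =>
    restrictForm le_top k ∘ₗ LinearMap.fst _ _ _ -
      pullbackForm π (mapsTo_preimage _ _) k ∘ₗ LinearMap.proj l ∘ₗ LinearMap.snd _ _ _

/-- The group `Ω̃^k` of the families of `k`-forms `ω̃_λ = ω̂ - π^*ω_λ` on the `π⁻¹(U_λ)`. -/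
abbrev TildeForm (π : C^∞⟮𝓘(ℝ, E'), N; 𝓘(ℝ, E), B⟯) (U : Λ → Opens B) (k : ℕ) :
    Submodule ℂ (∀ l, Form E' (preim π (U l)) k) :=
  LinearMap.range (tildeMap π U k)

/-- The exterior derivative of families of forms on the `π⁻¹(U_λ)`. -/
def familyD (π : C^∞⟮𝓘(ℝ, E'), N; 𝓘(ℝ, E), B⟯) (U : Λ → Opens B) (k : ℕ) :
    (∀ l, Form E' (preim π (U l)) k) →ₗ[ℂ] ∀ l, Form E' (preim π (U l)) (k + 1) :=
  LinearMap.pi fun l => extD (preim π (U l)) k ∘ₗ LinearMap.proj l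

theorem familyD_mem (π : C^∞⟮𝓘(ℝ, E'), N; 𝓘(ℝ, E), B⟯) (U : Λ → Opens B) (k : ℕ)
    (a : TildeForm π U k) : familyD π U k a.1 ∈ TildeForm π U (k + 1) := by
  obtain ⟨_, ⟨⟨α, β⟩, rfl⟩⟩ := a
  refine ⟨(extD ⊤ k α, fun l => extD (U l) k (β l)), ?_⟩
  funext l
  have h1 := extD_restrictForm (le_top : preim π (U l) ≤ ⊤) k α
  have h2 := extD_pullbackForm π (W := preim π (U l)) (mapsTo_preimage _ _) k (β l)
  simp only [tildeMap, familyD, LinearMap.pi_apply, LinearMap.sub_apply, LinearMap.comp_apply,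
    LinearMap.fst_apply, LinearMap.snd_apply, LinearMap.proj_apply, map_sub]
  exact congrArg₂ (· - ·) h1.symm h2.symm

/-- The exterior derivative `Ω̃^k → Ω̃^{k+1}`. -/
def tildeD (π : C^∞⟮𝓘(ℝ, E'), N; 𝓘(ℝ, E), B⟯) (U : Λ → Opens B) (k : ℕ) :
    TildeForm π U k →ₗ[ℂ] TildeForm π U (k + 1) :=
  ((familyD π U k).domRestrict (TildeForm π U k)).codRestrict _ (familyD_mem π U k)

/-- The cohomology `H̃^k(N → B)`, formed with the covering `U`. -/
abbrev TildeCohomology (π : C^∞⟮𝓘(ℝ, E'), N; 𝓘(ℝ, E), B⟯) (U : Λ → Opens B) (k : ℕ) : Type _ :=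
  Cohomology (C := fun n => TildeForm π U n) (tildeD π U) k

/-- The element `ω̃_λ = ω̂ - π^*ω_λ` of `Ω̃^k`. -/
def tilde (π : C^∞⟮𝓘(ℝ, E'), N; 𝓘(ℝ, E), B⟯) (U : Λ → Opens B) {k : ℕ}
    (α : Form E' (⊤ : Opens N) k) (β : ∀ l, Form E (U l) k) : TildeForm π U k :=
  ⟨tildeMap π U k (α, β), LinearMap.mem_range_self _ _⟩

end Relative
end CechDeRham
end

open CechDeRham

/-! A pair consisting of a form `ω̂` on the total space and forms `ω_λ` on the `U_λ` gives the
family `ω̃`. Since the bundle has local sections, `π^*` is injective at every point of `B`, and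
therefore `ω̃ = 0` exactly when the pair comes from one form `η` on `B`, with `ω_λ = η` on `U_λ` and
`ω̂ = π^*η` (`exists_of_tildeMap_eq_zero`). So `Ω̃^*` is the quotient of `Ω^*(𝒜) × ∏ Ω^*(U_λ)` by
`Ω^*(B)`. If `ω̃` is closed, then `dω̂` and the `dω_λ` come from one closed form `γ` on `B`; its
class is the image of `[ω̃]` under the connecting map. By the Poincaré lemma both factors are
acyclic in positive degrees, so `[ω̃]` vanishes iff `γ` is exact, and every closed `γ` occurs. The
same argument applies to `Ω^*(𝒜)/π^*Ω^*(B)`.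

On the Čech side, `γ` gives the cocycle `dω` of bidegree `(0, k + 1)`. A partition of unity makes
the rows exact (`exists_cechδ_eq`), so a primitive of this cocycle can be pushed into bidegree `(0,
k)` (`exists_cechD_eq_of_totalD_eq_single`), where it is a global form; again the class vanishes iff
`γ` is exact. Finally `δω + dω` is the total coboundary of `ω`, so `[δω] = -[dω]`, and the two parts
of the Čech-de Rham cohomology are matched up to sign.

Thus three linear maps on the pairs with closed `ω̃` have the same kernel as the map to `[ω̃]`,
given by `IsTrivialFamily`. With the computation of their ranges this yields all three isomorphisms
(`exists_cohomology_equiv`), and independence of the decomposition comes for free because the maps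
are defined on decompositions. -/

noncomputable section
namespace CechDeRham

/-! ### Smooth dependence of integrals on parameters -/

section ParametricIntegral
universe u
variable {E : Type u} [NormedAddCommGroup E] [NormedSpace ℝ E]

theorem continuous_slice {X : Type*} [TopologicalSpace X] {V : Set E} {f : ℝ × E → X}
    (hf : ContinuousOn f (univ ×ˢ V)) {y : E} (hy : y ∈ V) : Continuous fun t : ℝ => f (t, y) := by
  have : ContinuousOn (f ∘ fun t : ℝ => (t, y)) univ :=
    hf.comp (by fun_prop) fun t _ => ⟨mem_univ _, hy⟩
  exact continuousOn_univ.1 this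

theorem hasFDerivAt_integral_slice {X : Type*} [NormedAddCommGroup X] [NormedSpace ℝ X]
    {V : Set E} (hV : IsOpen V) {f : ℝ × E → X} (hf : ContDiffOn ℝ ∞ f (univ ×ˢ V))
    {y : E} (hy : y ∈ V) :
    HasFDerivAt (fun y => ∫ t in (0 : ℝ)..1, f (t, y))
      (∫ t in (0 : ℝ)..1, fderiv ℝ f (t, y) ∘L ContinuousLinearMap.inr ℝ ℝ E) y := by
  have hO : IsOpen ((univ : Set ℝ) ×ˢ V) := isOpen_univ.prod hV
  have hd : ContinuousOn (fun p => fderiv ℝ f p ∘L ContinuousLinearMap.inr ℝ ℝ E) (univ ×ˢ V) :=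
    (hf.continuousOn_fderiv_of_isOpen hO (by simp)).clm_comp continuousOn_const
  have hnorm : ContinuousOn (fun p => ‖fderiv ℝ f p ∘L ContinuousLinearMap.inr ℝ ℝ E‖)
    (univ ×ˢ V) := hd.norm
  obtain ⟨C, hC⟩ := (isCompact_Icc (a := (0 : ℝ)) (b := 1)).bddAbove_image
    (continuous_slice hnorm hy).continuousOn
  let O : Set (ℝ × E) := (univ ×ˢ V) ∩
    (fun p => ‖fderiv ℝ f p ∘L ContinuousLinearMap.inr ℝ ℝ E‖) ⁻¹' Iio (C + 1)
  have hOO : IsOpen O := hnorm.isOpen_inter_preimage hO isOpen_Iio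
  -- `E` need not be locally compact. The uniform bound on the derivative near `y` comes from the
  -- compactness of `[0, 1] × {y}` alone: the open set where the norm is below `C + 1` contains a
  -- tube around it.
  obtain ⟨S, W, -, hW, hS, hyW, hSW⟩ := generalized_tube_lemma
    (isCompact_Icc (a := (0 : ℝ)) (b := 1)) (isCompact_singleton (x := y)) hOO (by
      rintro ⟨t, z⟩ ⟨ht, hz⟩
      rw [mem_singleton_iff] at hz
      subst hz
      exact ⟨⟨mem_univ _, hy⟩, lt_of_le_of_lt (hC (mem_image_of_mem _ ht)) (lt_add_one C)⟩)
  have hWy : W ∈ 𝓝 y := hW.mem_nhds (singleton_subset_iff.1 hyW)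
  have hsub : ∀ t ∈ uIoc (0 : ℝ) 1, ∀ z ∈ W, (t, z) ∈ O := fun t ht z hz =>
    hSW ⟨hS (by rw [uIoc_of_le zero_le_one] at ht; exact Ioc_subset_Icc_self ht), hz⟩
  refine intervalIntegral.hasFDerivAt_integral_of_dominated_of_fderiv_le
    (F := fun y t => f (t, y))
    (F' := fun y t => fderiv ℝ f (t, y) ∘L ContinuousLinearMap.inr ℝ ℝ E)
    (bound := fun _ => C + 1) hWy ?_ ?_ ?_ ?_ ?_ ?_
  · filter_upwards [hV.mem_nhds hy] with z hz
    exact (continuous_slice hf.continuousOn hz).aestronglyMeasurable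
  · exact (continuous_slice hf.continuousOn hy).intervalIntegrable _ _
  · exact (continuous_slice hd hy).aestronglyMeasurable
  · exact Filter.Eventually.of_forall fun t ht z hz => le_of_lt (hsub t ht z hz).2
  · exact intervalIntegrable_const
  · refine Filter.Eventually.of_forall fun t ht z hz => ?_
    have h1 := ((hf.contDiffAt (hO.mem_nhds (hsub t ht z hz).1)).differentiableAt
      (by simp)).hasFDerivAt
    exact h1.comp z ((hasFDerivAt_const t z).prodMk (hasFDerivAt_id z))

/-- The derivative of such an integral is an integral of the same kind with values in `E →L[ℝ] X`,
so induction on the order works once `X` is generalized. For this `X` and `E` share a universe. -/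
theorem contDiffOn_integral_slice {X : Type u} [NormedAddCommGroup X] [NormedSpace ℝ X]
    {V : Set E} (hV : IsOpen V) {f : ℝ × E → X} (hf : ContDiffOn ℝ ∞ f (univ ×ˢ V)) :
    ContDiffOn ℝ ∞ (fun y => ∫ t in (0 : ℝ)..1, f (t, y)) V := by
  rw [contDiffOn_infty]
  intro n
  induction n generalizing X with
  | zero =>
    exact contDiffOn_zero.2 fun y hy =>
      (hasFDerivAt_integral_slice hV hf hy).continuousAt.continuousWithinAt
  | succ n ih =>
    have hO : IsOpen ((univ : Set ℝ) ×ˢ V) := isOpen_univ.prod hV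
    have hd : ContDiffOn ℝ ∞ (fun p => fderiv ℝ f p ∘L ContinuousLinearMap.inr ℝ ℝ E) (univ ×ˢ V) :=
      (hf.fderiv_of_isOpen hO (by simp)).clm_comp contDiffOn_const
    refine (contDiffOn_succ_iff_fderiv_of_isOpen (n := n) hV).2 ⟨fun y hy =>
      (hasFDerivAt_integral_slice hV hf hy).differentiableAt.differentiableWithinAt, by simp, ?_⟩
    exact (ih hd).congr fun y hy => (hasFDerivAt_integral_slice hV hf hy).fderiv

end ParametricIntegral

/-! ### The homotopy formula on a cylinder over an open subset of a normed space -/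

section LocalHomotopy
universe u
variable {E : Type u} [NormedAddCommGroup E] [NormedSpace ℝ E] {k : ℕ}

variable (E k) in
/-- Contraction of a form on `ℝ × E` with `∂/∂t`, followed by restriction to `E`. -/
def contractTime : ((ℝ × E) [⋀^Fin (k + 1)]→L[ℝ] ℂ) →L[ℝ] (E [⋀^Fin k]→L[ℝ] ℂ) :=
  ContinuousAlternatingMap.compContinuousLinearMapCLM (ContinuousLinearMap.inr ℝ ℝ E) ∘L
    (ContinuousLinearMap.apply ℝ _ ((1, 0) : ℝ × E)) ∘L
    (ContinuousAlternatingMap.curryLeftLI (𝕜 := ℝ) (E := ℝ × E) (F := ℂ) (n := k)).toContinuousLinearMap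

theorem contractTime_apply (a : (ℝ × E) [⋀^Fin (k + 1)]→L[ℝ] ℂ) (v : Fin k → E) :
    contractTime E k a v = a (Matrix.vecCons (1, 0) fun i => (0, v i)) := rfl

/-- The homotopy operator on forms on `ℝ × V`. -/
def fibreIntegral (θ : ℝ × E → (ℝ × E) [⋀^Fin (k + 1)]→L[ℝ] ℂ) (y : E) : E [⋀^Fin k]→L[ℝ] ℂ :=
  ∫ t in (0 : ℝ)..1, contractTime E k (θ (t, y))

theorem contDiffOn_fibreIntegral {V : Set E} (hV : IsOpen V)
    {θ : ℝ × E → (ℝ × E) [⋀^Fin (k + 1)]→L[ℝ] ℂ} (hθ : ContDiffOn ℝ ∞ θ (univ ×ˢ V)) :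
    ContDiffOn ℝ ∞ (fibreIntegral θ) V :=
  contDiffOn_integral_slice hV ((contractTime E k).contDiff.comp_contDiffOn hθ)

/-- Cartan's formula for the field `∂/∂t`: the Lie derivative of a closed form is `d` of its
contraction. Restricted to a slice, the Lie derivative is the time derivative. -/
theorem hasDerivAt_slice_of_closed {V : Set E} (hV : IsOpen V)
    {θ : ℝ × E → (ℝ × E) [⋀^Fin (k + 1)]→L[ℝ] ℂ} (hθ : ContDiffOn ℝ ∞ θ (univ ×ˢ V))
    {y : E} (hy : y ∈ V) (t : ℝ) (hd : extDeriv θ (t, y) = 0) :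
    HasDerivAt (fun t => (θ (t, y)).compContinuousLinearMap (ContinuousLinearMap.inr ℝ ℝ E))
      (ContinuousAlternatingMap.alternatizeUncurryFinCLM ℝ E ℂ
        (fderiv ℝ (fun p => contractTime E k (θ p)) (t, y) ∘L ContinuousLinearMap.inr ℝ ℝ E)) t := by
  have hO : IsOpen ((univ : Set ℝ) ×ˢ V) := isOpen_univ.prod hV
  have h1 : DifferentiableAt ℝ θ (t, y) :=
    (hθ.contDiffAt (hO.mem_nhds ⟨mem_univ _, hy⟩)).differentiableAt (by simp)
  have h2 : HasDerivAt (fun t => θ (t, y)) (fderiv ℝ θ (t, y) (1, 0)) t := by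
    have := h1.hasFDerivAt.comp_hasDerivAt t
      ((hasDerivAt_id t).prodMk (hasDerivAt_const t y))
    exact this
  have h3 := (ContinuousAlternatingMap.compContinuousLinearMapCLM (𝕜 := ℝ) (F := ℂ) (ι := Fin (k + 1))
    (ContinuousLinearMap.inr ℝ ℝ E)).hasFDerivAt.comp_hasDerivAt t h2
  refine h3.congr_deriv ?_
  have h4 : fderiv ℝ (fun p => contractTime E k (θ p)) (t, y) =
      contractTime E k ∘L fderiv ℝ θ (t, y) :=
    ((contractTime E k).hasFDerivAt.comp _ h1.hasFDerivAt).fderiv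
  ext v
  -- Evaluate `dθ = 0` on `∂/∂t, v₀, …, vₖ`. The first summand is the time derivative; the others,
  -- with signs shifted by one place, form minus the exterior derivative of the contraction in the
  -- directions of `E`.
  have h5 := DFunLike.congr_fun hd (Matrix.vecCons ((1, 0) : ℝ × E) fun i => ((0 : ℝ), v i))
  rw [extDeriv, ContinuousAlternatingMap.alternatizeUncurryFin_apply, Fin.sum_univ_succ] at h5
  rw [h4]
  simp only [ContinuousAlternatingMap.alternatizeUncurryFinCLM_apply,
    ContinuousAlternatingMap.alternatizeUncurryFin_apply]
  have h6 : ∀ x : Fin (k + 1), (Fin.succ x).removeNth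
      (Matrix.vecCons ((1, 0) : ℝ × E) fun i => ((0 : ℝ), v i)) =
      Matrix.vecCons ((1, 0) : ℝ × E) fun i => ((0 : ℝ), x.removeNth v i) := by
    intro x
    funext i
    refine Fin.cases ?_ (fun j => ?_) i
    · simp [Fin.removeNth]
    · simp [Fin.removeNth]
  simp only [h6] at h5
  rw [show (0 : (ℝ × E) [⋀^Fin (k + 2)]→L[ℝ] ℂ) _ = 0 from rfl, add_eq_zero_iff_eq_neg, ← Finset.sum_neg_distrib] at h5
  refine Eq.trans ?_ (h5.trans (Finset.sum_congr rfl fun i _ => ?_))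
  · simp [Function.comp_def]
  · simp [pow_succ, contractTime_apply]

-- Differentiation and alternatization, both linear, pass under the integral. The integrand is then
-- a time derivative by `hasDerivAt_slice_of_closed`, and the fundamental theorem of calculus leaves
-- the two end slices.
set_option maxSynthPendingDepth 3 in
theorem extDeriv_fibreIntegral {V : Set E} (hV : IsOpen V)
    {θ : ℝ × E → (ℝ × E) [⋀^Fin (k + 1)]→L[ℝ] ℂ} (hθ : ContDiffOn ℝ ∞ θ (univ ×ˢ V))
    (hd : ∀ p ∈ (univ : Set ℝ) ×ˢ V, extDeriv θ p = 0) {y : E} (hy : y ∈ V) :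
    extDeriv (fibreIntegral θ) y =
      (θ (1, y)).compContinuousLinearMap (ContinuousLinearMap.inr ℝ ℝ E) -
      (θ (0, y)).compContinuousLinearMap (ContinuousLinearMap.inr ℝ ℝ E) := by
  have hO : IsOpen ((univ : Set ℝ) ×ˢ V) := isOpen_univ.prod hV
  have hc : ContDiffOn ℝ ∞ (fun p => contractTime E k (θ p)) (univ ×ˢ V) :=
    (contractTime E k).contDiff.comp_contDiffOn hθ
  have hcd : ContinuousOn (fun p => fderiv ℝ (fun p => contractTime E k (θ p)) p ∘L
      ContinuousLinearMap.inr ℝ ℝ E) (univ ×ˢ V) :=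
    (hc.continuousOn_fderiv_of_isOpen hO (by simp)).clm_comp continuousOn_const
  have hi : IntervalIntegrable (fun t => fderiv ℝ (fun p => contractTime E k (θ p)) (t, y) ∘L
      ContinuousLinearMap.inr ℝ ℝ E) MeasureTheory.volume 0 1 :=
    (continuous_slice hcd hy).intervalIntegrable _ _
  rw [extDeriv, show fderiv ℝ (fibreIntegral θ) y = _ from (hasFDerivAt_integral_slice hV hc hy).fderiv,
    ← ContinuousAlternatingMap.alternatizeUncurryFinCLM_apply]
  refine (ContinuousLinearMap.intervalIntegral_comp_comm
    (ContinuousAlternatingMap.alternatizeUncurryFinCLM ℝ E ℂ)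
    hi).symm.trans ?_
  refine intervalIntegral.integral_eq_sub_of_hasDerivAt
    (f := fun t => (θ (t, y)).compContinuousLinearMap (ContinuousLinearMap.inr ℝ ℝ E))
    (fun t _ => hasDerivAt_slice_of_closed hV hθ hy t (hd _ ⟨mem_univ _, hy⟩)) ?_
  exact ((ContinuousLinearMap.continuous _).comp (continuous_slice hcd hy)).intervalIntegrable _ _

end LocalHomotopy

/-! ### Pull-backs along maps that are smooth only on an open set, as contractions are -/

section LocalPullback
variable {E M : Type*} [NormedAddCommGroup E] [NormedSpace ℝ E]
  [TopologicalSpace M] [ChartedSpace E M] [IsManifold 𝓘(ℝ, E) ∞ M]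
  {E' N : Type*} [NormedAddCommGroup E'] [NormedSpace ℝ E']
  [TopologicalSpace N] [ChartedSpace E' N] [IsManifold 𝓘(ℝ, E') ∞ N] {k : ℕ}

theorem contDiffAt_coordMap_of_contMDiffAt {f : N → M} (x₀ : N) (z₀ : M) {y : E'}
    (hf : ContMDiffAt 𝓘(ℝ, E') 𝓘(ℝ, E) ∞ f ((extChartAt 𝓘(ℝ, E') x₀).symm y))
    (hy : y ∈ (extChartAt 𝓘(ℝ, E') x₀).target)
    (hz : f ((extChartAt 𝓘(ℝ, E') x₀).symm y) ∈ (extChartAt 𝓘(ℝ, E) z₀).source) :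
    ContDiffAt ℝ ∞ (coordMap E E' f x₀ z₀) y := by
  rw [← contMDiffAt_iff_contDiffAt]
  rw [extChartAt_source] at hz
  exact (contMDiffAt_extChartAt' hz).comp y (hf.comp y (contMDiffAt_symm x₀ hy))

theorem eventually_coord_of_continuousAt {f : N → M} (x₀ : N) (z₀ : M) {y : E'}
    (hf : ContinuousAt f ((extChartAt 𝓘(ℝ, E') x₀).symm y))
    (hy : y ∈ (extChartAt 𝓘(ℝ, E') x₀).target)
    (hz : f ((extChartAt 𝓘(ℝ, E') x₀).symm y) ∈ (extChartAt 𝓘(ℝ, E) z₀).source) :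
    ∀ᶠ y' in 𝓝 y, y' ∈ (extChartAt 𝓘(ℝ, E') x₀).target ∧
      f ((extChartAt 𝓘(ℝ, E') x₀).symm y') ∈ (extChartAt 𝓘(ℝ, E) z₀).source := by
  refine ((isOpen_extChartAt_target x₀).eventually_mem hy).and ?_
  have h1 : ContinuousAt (f ∘ (extChartAt 𝓘(ℝ, E') x₀).symm) y :=
    hf.comp (continuousAt_extChartAt_symm'' hy)
  exact h1.eventually ((isOpen_extChartAt_source z₀).eventually_mem hz)

/-- Near `y` the maps `f ∘ φ⁻¹` (with `φ` the chart at `x₀`) and `ψ⁻¹ ∘ g` (with `ψ` the chart at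
`z₀` and `g` the coordinate expression of `f`) agree. The chain rule on both sides gives the
identity. -/
theorem chartRep_rawPullback_of_contMDiffAt {f : N → M} (α : RawForm E M k) (x₀ : N) (z₀ : M)
    {y : E'} (hf : ContMDiffAt 𝓘(ℝ, E') 𝓘(ℝ, E) ∞ f ((extChartAt 𝓘(ℝ, E') x₀).symm y))
    (hy : y ∈ (extChartAt 𝓘(ℝ, E') x₀).target)
    (hz : f ((extChartAt 𝓘(ℝ, E') x₀).symm y) ∈ (extChartAt 𝓘(ℝ, E) z₀).source) :
    chartRep (rawPullback f α) x₀ y =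
      (chartRep α z₀ (coordMap E E' f x₀ z₀ y)).compContinuousLinearMap
        (fderiv ℝ (coordMap E E' f x₀ z₀) y) := by
  have hback : (extChartAt 𝓘(ℝ, E) z₀).symm (coordMap E E' f x₀ z₀ y)
      = f ((extChartAt 𝓘(ℝ, E') x₀).symm y) := (extChartAt 𝓘(ℝ, E) z₀).left_inv hz
  have hgt : coordMap E E' f x₀ z₀ y ∈ (extChartAt 𝓘(ℝ, E) z₀).target :=
    (extChartAt 𝓘(ℝ, E) z₀).map_source hz
  have hψ := (contMDiffAt_symm x₀ hy).mdifferentiableAt (by simp)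
  have hφ := (contMDiffAt_symm z₀ hgt).mdifferentiableAt (by simp)
  have hg := ((contDiffAt_coordMap_of_contMDiffAt x₀ z₀ hf hy hz).contMDiffAt).mdifferentiableAt
    (by simp)
  have hff := hf.mdifferentiableAt (by simp)
  have e1 := mfderiv_comp y hff hψ
  have e2 := mfderiv_comp y hφ hg
  have e3 : f ∘ (extChartAt 𝓘(ℝ, E') x₀).symm =ᶠ[𝓝 y]
      (extChartAt 𝓘(ℝ, E) z₀).symm ∘ coordMap E E' f x₀ z₀ := by
    filter_upwards [eventually_coord_of_continuousAt x₀ z₀ hf.continuousAt hy hz] with y' hy'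
    exact ((extChartAt 𝓘(ℝ, E) z₀).left_inv hy'.2).symm
  have e4 := e3.mfderiv_eq (I := 𝓘(ℝ, E')) (I' := 𝓘(ℝ, E))
  ext v
  have key : ∀ u : E', (mfderiv 𝓘(ℝ, E') 𝓘(ℝ, E) f ((extChartAt 𝓘(ℝ, E') x₀).symm y)
      (mfderiv 𝓘(ℝ, E') 𝓘(ℝ, E') (extChartAt 𝓘(ℝ, E') x₀).symm y u) : E) =
      mfderiv 𝓘(ℝ, E) 𝓘(ℝ, E) (extChartAt 𝓘(ℝ, E) z₀).symm (coordMap E E' f x₀ z₀ y)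
        (fderiv ℝ (coordMap E E' f x₀ z₀) y u) := by
    intro u
    have h1 := DFunLike.congr_fun e1 u
    have h2 := DFunLike.congr_fun e2 u
    rw [mfderiv_eq_fderiv] at h2
    refine h1.symm.trans (Eq.trans ?_ h2)
    exact DFunLike.congr_fun e4 u
  -- The types of the derivatives mention their base points, so the equality of points is
  -- transported through the value of the form on a fixed tuple of vectors.
  have hα : ∀ p q : M, p = q → ∀ w : Fin k → E, (α p : E [⋀^Fin k]→L[ℝ] ℂ) w
      = (α q : E [⋀^Fin k]→L[ℝ] ℂ) w := by rintro p q rfl w; rfl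
  refine Eq.trans ?_ (hα _ _ hback.symm _)
  exact congrArg (fun w => (α (f ((extChartAt 𝓘(ℝ, E') x₀).symm y)) : E [⋀^Fin k]→L[ℝ] ℂ) w)
    (funext fun i => key (v i))

theorem eventually_chartRep_rawPullback {f : N → M} {W : Opens N}
    (hf : ContMDiffOn 𝓘(ℝ, E') 𝓘(ℝ, E) ∞ f W) (α : RawForm E M k) (x₀ : N) (z₀ : M) {y : E'}
    (hy : y ∈ chartDom E' W x₀)
    (hz : f ((extChartAt 𝓘(ℝ, E') x₀).symm y) ∈ (extChartAt 𝓘(ℝ, E) z₀).source) :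
    chartRep (rawPullback f α) x₀ =ᶠ[𝓝 y] fun y' =>
      (chartRep α z₀ (coordMap E E' f x₀ z₀ y')).compContinuousLinearMap
        (fderiv ℝ (coordMap E E' f x₀ z₀) y') := by
  have hfa := fun x (hx : x ∈ W) => hf.contMDiffAt (W.2.mem_nhds hx)
  filter_upwards [eventually_coord_of_continuousAt x₀ z₀ (hfa _ hy.2).continuousAt hy.1 hz,
    (isOpen_chartDom W x₀).mem_nhds hy] with y' hy' hW
  exact chartRep_rawPullback_of_contMDiffAt α x₀ z₀ (hfa _ hW.2) hy'.1 hy'.2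

theorem smoothOn_rawPullback_of_contMDiffOn {f : N → M} {U : Opens M} {W : Opens N}
    (hf : ContMDiffOn 𝓘(ℝ, E') 𝓘(ℝ, E) ∞ f W)
    (h : MapsTo f W U) {α : RawForm E M k} (hα : SmoothOn U α) :
    SmoothOn W (rawPullback f α : RawForm E' N k) := by
  intro x₀ y hy
  refine ContDiffAt.contDiffWithinAt ?_
  set z₀ := f ((extChartAt 𝓘(ℝ, E') x₀).symm y)
  have hz : f ((extChartAt 𝓘(ℝ, E') x₀).symm y) ∈ (extChartAt 𝓘(ℝ, E) z₀).source :=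
    mem_extChartAt_source _
  have hg := contDiffAt_coordMap_of_contMDiffAt x₀ z₀ (hf.contMDiffAt (W.2.mem_nhds hy.2)) hy.1 hz
  have hback : (extChartAt 𝓘(ℝ, E) z₀).symm (coordMap E E' f x₀ z₀ y)
      = f ((extChartAt 𝓘(ℝ, E') x₀).symm y) := (extChartAt 𝓘(ℝ, E) z₀).left_inv hz
  have hgd : coordMap E E' f x₀ z₀ y ∈ chartDom E U z₀ := by
    refine ⟨(extChartAt 𝓘(ℝ, E) z₀).map_source hz, ?_⟩
    rw [mem_preimage, hback]; exact h hy.2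
  have h1 : ContDiffAt ℝ ∞ (chartRep α z₀) (coordMap E E' f x₀ z₀ y) :=
    (hα z₀).contDiffAt ((isOpen_chartDom U z₀).mem_nhds hgd)
  have h2 := contDiff_comp_alternating.contDiffAt.comp y
    ((h1.comp y hg).prodMk (hg.fderiv_right (m := ∞) (by simp)))
  exact h2.congr_of_eventuallyEq (eventually_chartRep_rawPullback hf α x₀ z₀ hy hz)

theorem rawD_rawPullback_of_contMDiffOn {f : N → M} {U : Opens M} {W : Opens N}
    (hf : ContMDiffOn 𝓘(ℝ, E') 𝓘(ℝ, E) ∞ f W) (h : MapsTo f W U)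
    {α : RawForm E M k} (hα : SmoothOn U α) {x : N} (hx : x ∈ W) :
    rawD (rawPullback f α : RawForm E' N k) x = rawPullback f (rawD α) x := by
  apply eq_of_chartRep
  have hW := smoothOn_rawPullback_of_contMDiffOn hf h hα
  have hfx : ContMDiffAt 𝓘(ℝ, E') 𝓘(ℝ, E) ∞ f
      ((extChartAt 𝓘(ℝ, E') x).symm (extChartAt 𝓘(ℝ, E') x x)) := by
    rw [extChartAt_to_inv]; exact hf.contMDiffAt (W.2.mem_nhds hx)
  have hxs : f ((extChartAt 𝓘(ℝ, E') x).symm (extChartAt 𝓘(ℝ, E') x x)) ∈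
      (extChartAt 𝓘(ℝ, E) (f x)).source := by
    rw [extChartAt_to_inv]; exact mem_extChartAt_source _
  have hy := mem_extChartAt_target (I := 𝓘(ℝ, E')) x
  have hg := contDiffAt_coordMap_of_contMDiffAt x (f x) hfx hy hxs
  have hgy : coordMap E E' f x (f x) (extChartAt 𝓘(ℝ, E') x x)
      = extChartAt 𝓘(ℝ, E) (f x) (f x) := by simp [coordMap]
  have hmem := mem_chartDom_self (E := E) (h hx)
  have h1 : ContDiffAt ℝ ∞ (chartRep α (f x))
      (coordMap E E' f x (f x) (extChartAt 𝓘(ℝ, E') x x)) := by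
    rw [hgy]
    exact (hα (f x)).contDiffAt ((isOpen_chartDom U (f x)).mem_nhds hmem)
  rw [chartRep_rawD hW x (mem_chartDom_self hx),
    chartRep_rawPullback_of_contMDiffAt _ x (f x) hfx hy hxs,
    (eventually_chartRep_rawPullback hf α x (f x) (mem_chartDom_self hx) hxs).extDeriv_eq,
    extDeriv_pullback (h1.differentiableAt (by simp)) hg two_le_infty, chartRep_rawD hα (f x)]
  rw [hgy]; exact hmem

/-- The value of a form at a point in terms of its expression in the chart at that point. -/
theorem eq_comp_chartRep (α : RawForm E M k) (x : M) :
    α x = (chartRep α x (extChartAt 𝓘(ℝ, E) x x)).compContinuousLinearMap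
      (mfderiv 𝓘(ℝ, E) 𝓘(ℝ, E) (extChartAt 𝓘(ℝ, E) x) x) := by
  have e1 := mfderiv_comp x
    ((contMDiffAt_symm x (mem_extChartAt_target x)).mdifferentiableAt (by simp))
    ((contMDiffAt_extChartAt (I := 𝓘(ℝ, E)) (n := ∞) (x := x)).mdifferentiableAt (by simp))
  have e2 : (extChartAt 𝓘(ℝ, E) x).symm ∘ extChartAt 𝓘(ℝ, E) x =ᶠ[𝓝 x] id := by
    filter_upwards [extChartAt_source_mem_nhds (I := 𝓘(ℝ, E)) x] with z hz
    exact (extChartAt 𝓘(ℝ, E) x).left_inv hz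
  have e3 := e2.mfderiv_eq (I := 𝓘(ℝ, E)) (I' := 𝓘(ℝ, E))
  have hα : ∀ p q : M, p = q → ∀ w : Fin k → E, (α p : E [⋀^Fin k]→L[ℝ] ℂ) w
    = (α q : E [⋀^Fin k]→L[ℝ] ℂ) w := by rintro p q rfl w; rfl
  ext v
  refine Eq.trans ?_ (hα _ _ (extChartAt_to_inv x).symm _)
  refine congrArg (α x : E [⋀^Fin k]→L[ℝ] ℂ) (funext fun i => ?_)
  have h1 := DFunLike.congr_fun e1 (v i)
  have h2 := DFunLike.congr_fun e3 (v i)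
  have h3 : (mfderiv 𝓘(ℝ, E) 𝓘(ℝ, E) (id : M → M) x) (v i) = v i := by
    rw [mfderiv_id]; rfl
  exact h3.symm.trans (h2.symm.trans h1)

end LocalPullback

/-! ### Forms on a normed space, where charts are the identity -/

section ModelSpace
variable {E : Type*} [NormedAddCommGroup E] [NormedSpace ℝ E] {k : ℕ}

theorem chartRep_modelSpace (α : RawForm E E k) (x₀ : E) : chartRep α x₀ = α := by
  have h : ∀ y : E, mfderiv 𝓘(ℝ, E) 𝓘(ℝ, E) (extChartAt 𝓘(ℝ, E) x₀).symm y =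
      ContinuousLinearMap.id ℝ E := by
    intro y
    rw [mfderiv_eq_fderiv, extChartAt_model_space_eq_id]
    exact fderiv_id
  funext y
  ext v
  simp only [chartRep, h]
  rw [extChartAt_model_space_eq_id]
  rfl

theorem chartDom_modelSpace (U : Opens E) (x₀ : E) : chartDom E U x₀ = U := by
  simp only [chartDom, extChartAt_model_space_eq_id]
  simp

theorem SmoothOn.contDiffOn {U : Opens E} {α : RawForm E E k} (h : SmoothOn U α) :
    ContDiffOn ℝ ∞ α U := by
  simpa only [chartRep_modelSpace, chartDom_modelSpace] using h 0

theorem rawD_modelSpace {U : Opens E} {α : RawForm E E k} (h : SmoothOn U α) {x : E} (hx : x ∈ U) :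
    rawD α x = extDeriv α x := by
  have := chartRep_rawD h x (mem_chartDom_self hx)
  simp only [chartRep_modelSpace, extChartAt_model_space_eq_id] at this
  exact this

end ModelSpace

/-! ### The Poincaré lemma for smoothly contractible open sets -/

section Poincare
universe u
variable {E : Type u} {M : Type*} [NormedAddCommGroup E] [NormedSpace ℝ E]
  [TopologicalSpace M] [ChartedSpace E M] [IsManifold 𝓘(ℝ, E) ∞ M] {k : ℕ}

/-- The contraction with `∂/∂t` of the pull-back of a form by a homotopy `H`, restricted to time
`t`. -/
def homotopyIntegrand (H : ℝ × M → M) (α : RawForm E M (k + 1)) (t : ℝ) : RawForm E M k := fun x =>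
  ContinuousAlternatingMap.compContinuousLinearMap
    ((α (H (t, x)) : E [⋀^Fin (k + 1)]→L[ℝ] ℂ).curryLeft
      (mfderiv 𝓘(ℝ, ℝ) 𝓘(ℝ, E) (fun s => H (s, x)) t (1 : ℝ) : E))
    (mfderiv 𝓘(ℝ, E) 𝓘(ℝ, E) (fun z => H (t, z)) x : E →L[ℝ] E)

/-- The homotopy operator belonging to a smooth homotopy `H`. -/
def homotopyOperator (H : ℝ × M → M) (α : RawForm E M (k + 1)) : RawForm E M k := fun x =>
  ∫ t in (0 : ℝ)..1, (homotopyIntegrand H α t x : E [⋀^Fin k]→L[ℝ] ℂ)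

/-- A homotopy in a chart. -/
def chartHomotopy (E : Type*) [NormedAddCommGroup E] [NormedSpace ℝ E] {M : Type*}
    [TopologicalSpace M] [ChartedSpace E M] (H : ℝ × M → M) (x₀ : M) : ℝ × E → M :=
  fun p => H (p.1, (extChartAt 𝓘(ℝ, E) x₀).symm p.2)

/-- The set `ℝ × V`, where `V` corresponds to `W` in the chart at `x₀`. -/
def chartCylinder (E : Type*) [NormedAddCommGroup E] [NormedSpace ℝ E] {M : Type*}
    [TopologicalSpace M] [ChartedSpace E M] (W : Opens M) (x₀ : M) : Opens (ℝ × E) :=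
  ⟨univ ×ˢ chartDom E W x₀, isOpen_univ.prod (isOpen_chartDom W x₀)⟩

variable {W : Opens M} {H : ℝ × M → M}
  (hH : ContMDiffOn (𝓘(ℝ, ℝ).prod 𝓘(ℝ, E)) 𝓘(ℝ, E) ∞ H (univ ×ˢ (W : Set M)))
  (hW : ∀ t, ∀ x ∈ W, H (t, x) ∈ W)

include hH in
theorem contMDiffOn_chartHomotopy (x₀ : M) :
    ContMDiffOn 𝓘(ℝ, ℝ × E) 𝓘(ℝ, E) ∞ (chartHomotopy E H x₀) (chartCylinder E W x₀) := by
  have h1 : ContMDiffOn 𝓘(ℝ, ℝ × E) 𝓘(ℝ, ℝ) ∞ (fun p : ℝ × E => p.1) (chartCylinder E W x₀) :=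
    contDiff_fst.contMDiff.contMDiffOn
  have h2 : ContMDiffOn 𝓘(ℝ, ℝ × E) 𝓘(ℝ, E) ∞
      (fun p : ℝ × E => (extChartAt 𝓘(ℝ, E) x₀).symm p.2) (chartCylinder E W x₀) :=
    (contMDiffOn_extChartAt_symm x₀).comp (t := (extChartAt 𝓘(ℝ, E) x₀).target)
      (contDiff_snd.contMDiff.contMDiffOn (I := 𝓘(ℝ, ℝ × E)) (I' := 𝓘(ℝ, E))) fun p hp => hp.2.1
  exact hH.comp (h1.prodMk h2) fun p hp => ⟨mem_univ _, hp.2.2⟩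

include hH in
theorem contMDiffAt_slice {t : ℝ} {x : M} (hx : x ∈ W) :
    ContMDiffAt 𝓘(ℝ, E) 𝓘(ℝ, E) ∞ (fun z => H (t, z)) x :=
  (hH.contMDiffAt ((isOpen_univ.prod W.2).mem_nhds ⟨mem_univ _, hx⟩)).comp x
    (contMDiffAt_const.prodMk contMDiffAt_id)

theorem mfderiv_partial_snd {G : ℝ × E → M} {t : ℝ} {y : E}
    (hG : MDifferentiableAt 𝓘(ℝ, ℝ × E) 𝓘(ℝ, E) G (t, y)) (v : E) :
    (mfderiv 𝓘(ℝ, ℝ × E) 𝓘(ℝ, E) G (t, y) ((0, v) : ℝ × E) : E) =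
      mfderiv 𝓘(ℝ, E) 𝓘(ℝ, E) (fun z => G (t, z)) y v := by
  have h1 : HasFDerivAt (fun z : E => (t, z)) (ContinuousLinearMap.inr ℝ ℝ E) y :=
    (hasFDerivAt_const t y).prodMk (hasFDerivAt_id y)
  have h2 := mfderiv_comp (I := 𝓘(ℝ, E)) (I' := 𝓘(ℝ, ℝ × E)) y hG
    h1.differentiableAt.mdifferentiableAt
  rw [mfderiv_eq_fderiv, h1.fderiv] at h2
  exact (DFunLike.congr_fun h2 v).symm

theorem mfderiv_partial_fst {G : ℝ × E → M} {t : ℝ} {y : E}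
    (hG : MDifferentiableAt 𝓘(ℝ, ℝ × E) 𝓘(ℝ, E) G (t, y)) (v : ℝ) :
    (mfderiv 𝓘(ℝ, ℝ × E) 𝓘(ℝ, E) G (t, y) ((v, 0) : ℝ × E) : E) =
      mfderiv 𝓘(ℝ, ℝ) 𝓘(ℝ, E) (fun s => G (s, y)) t v := by
  have h1 : HasFDerivAt (fun s : ℝ => (s, y)) (ContinuousLinearMap.inl ℝ ℝ E) t :=
    (hasFDerivAt_id t).prodMk (hasFDerivAt_const y t)
  have h2 := mfderiv_comp (I := 𝓘(ℝ, ℝ)) (I' := 𝓘(ℝ, ℝ × E)) t hG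
    h1.differentiableAt.mdifferentiableAt
  rw [mfderiv_eq_fderiv, h1.fderiv] at h2
  exact (DFunLike.congr_fun h2 v).symm

-- In a chart the intrinsic integrand becomes the contraction of a form on the flat cylinder. This
-- carries smoothness and the homotopy formula over from the normed space to the manifold.
include hH in
theorem chartRep_homotopyIntegrand (α : RawForm E M (k + 1)) (t : ℝ) (x₀ : M) {y : E}
    (hy : y ∈ chartDom E W x₀) :
    chartRep (homotopyIntegrand H α t) x₀ y =
      contractTime E k (rawPullback (chartHomotopy E H x₀) α (t, y)) := by
  have hG : MDifferentiableAt 𝓘(ℝ, ℝ × E) 𝓘(ℝ, E) (chartHomotopy E H x₀) (t, y) :=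
    ((contMDiffOn_chartHomotopy hH x₀).contMDiffAt
      ((chartCylinder E W x₀).2.mem_nhds ⟨mem_univ _, hy⟩)).mdifferentiableAt (by simp)
  have hx := (contMDiffAt_slice hH (t := t) hy.2).mdifferentiableAt (by simp)
  have hc := mfderiv_comp y hx ((contMDiffAt_symm x₀ hy.1).mdifferentiableAt (by simp))
  ext v
  rw [contractTime_apply]
  refine congrArg (α (H (t, (extChartAt 𝓘(ℝ, E) x₀).symm y)) : E [⋀^Fin (k + 1)]→L[ℝ] ℂ)
    (funext fun i => ?_)
  refine Fin.cases ?_ (fun j => ?_) i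
  · exact (mfderiv_partial_fst hG 1).symm
  · exact (DFunLike.congr_fun hc (v j)).symm.trans (mfderiv_partial_snd hG (v j)).symm

variable {α : RawForm E M (k + 1)} (hα : SmoothOn W α)

include hH hW hα in
theorem contDiffOn_rawPullback_chartHomotopy (x₀ : M) :
    ContDiffOn ℝ ∞ (rawPullback (chartHomotopy E H x₀) α : RawForm (ℝ × E) (ℝ × E) (k + 1))
      (univ ×ˢ chartDom E W x₀) :=
  (smoothOn_rawPullback_of_contMDiffOn (contMDiffOn_chartHomotopy hH x₀)
    (fun p hp => hW p.1 _ hp.2.2) hα).contDiffOn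

-- Continuity in time is what allows fixed linear maps, such as the derivative of a chart, to be
-- moved through the integral of `homotopyOperator`.
include hH hW hα in
theorem continuous_homotopyIntegrand {x : M} (hx : x ∈ W) :
    Continuous fun t => (homotopyIntegrand H α t x : E [⋀^Fin k]→L[ℝ] ℂ) := by
  have h1 := continuous_slice
    ((contDiffOn_rawPullback_chartHomotopy hH hW hα x).continuousOn) (mem_chartDom_self hx)
  have h2 := (ContinuousAlternatingMap.compContinuousLinearMapCLM (F := ℂ) (ι := Fin k)
    (mfderiv 𝓘(ℝ, E) 𝓘(ℝ, E) (extChartAt 𝓘(ℝ, E) x) x : E →L[ℝ] E)).continuous.comp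
    ((contractTime E k).continuous.comp h1)
  refine h2.congr fun t => ?_
  exact ((eq_comp_chartRep (homotopyIntegrand H α t) x).trans (by
    rw [chartRep_homotopyIntegrand hH α t x (mem_chartDom_self hx)]; rfl)).symm

theorem integral_compContinuousLinearMap {f : ℝ → E [⋀^Fin k]→L[ℝ] ℂ} (hf : Continuous f)
    (L : E →L[ℝ] E) : ∫ t in (0 : ℝ)..1, (f t).compContinuousLinearMap L =
      (∫ t in (0 : ℝ)..1, f t).compContinuousLinearMap L :=
  ContinuousLinearMap.intervalIntegral_comp_comm
    (ContinuousAlternatingMap.compContinuousLinearMapCLM (F := ℂ) (ι := Fin k) L)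
    (hf.intervalIntegrable _ _)

include hH hW hα in
theorem chartRep_homotopyOperator (x₀ : M) :
    EqOn (chartRep (homotopyOperator H α) x₀)
      (fibreIntegral (rawPullback (chartHomotopy E H x₀) α)) (chartDom E W x₀) := by
  intro y hy
  have h := integral_compContinuousLinearMap (continuous_homotopyIntegrand hH hW hα hy.2)
    (mfderiv 𝓘(ℝ, E) 𝓘(ℝ, E) (extChartAt 𝓘(ℝ, E) x₀).symm y)
  refine h.symm.trans (intervalIntegral.integral_congr fun t _ => ?_)
  exact chartRep_homotopyIntegrand hH α t x₀ hy

include hH hW hα in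
theorem smoothOn_homotopyOperator : SmoothOn W (homotopyOperator H α) := fun x₀ =>
  (contDiffOn_fibreIntegral (isOpen_chartDom W x₀)
    (contDiffOn_rawPullback_chartHomotopy hH hW hα x₀)).congr
    (chartRep_homotopyOperator hH hW hα x₀)

include hH hW hα in
/-- The homotopy operator of a contraction inverts the exterior derivative on closed forms. -/
theorem rawD_homotopyOperator {b₀ : M} (h0 : ∀ x ∈ W, H (0, x) = b₀) (h1 : ∀ x ∈ W, H (1, x) = x)
    (hd : ∀ x ∈ W, rawD α x = 0) {x : M} (hx : x ∈ W) : rawD (homotopyOperator H α) x = α x := by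
  apply eq_of_chartRep
  have hy : extChartAt 𝓘(ℝ, E) x x ∈ chartDom E W x := mem_chartDom_self hx
  generalize extChartAt 𝓘(ℝ, E) x x = y at hy ⊢
  have hnhds := (isOpen_chartDom W x).mem_nhds hy
  rw [chartRep_rawD (smoothOn_homotopyOperator hH hW hα) x hy,
    (Filter.eventuallyEq_of_mem hnhds (chartRep_homotopyOperator hH hW hα x)).extDeriv_eq,
    extDeriv_fibreIntegral (isOpen_chartDom W x)
      (contDiffOn_rawPullback_chartHomotopy hH hW hα x) ?_ hy]
  · have hG : ∀ t, MDifferentiableAt 𝓘(ℝ, ℝ × E) 𝓘(ℝ, E) (chartHomotopy E H x) (t, y) := fun t =>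
      ((contMDiffOn_chartHomotopy hH x).contMDiffAt
        ((chartCylinder E W x).2.mem_nhds ⟨mem_univ _, hy⟩)).mdifferentiableAt (by simp)
    have e1 : (fun z => chartHomotopy E H x (1, z)) =ᶠ[𝓝 y] (extChartAt 𝓘(ℝ, E) x).symm :=
      Filter.eventuallyEq_of_mem hnhds fun z hz => h1 _ hz.2
    have e0 : (fun z => chartHomotopy E H x (0, z)) =ᶠ[𝓝 y] fun _ => b₀ :=
      Filter.eventuallyEq_of_mem hnhds fun z hz => h0 _ hz.2
    have d1 := e1.mfderiv_eq (I := 𝓘(ℝ, E)) (I' := 𝓘(ℝ, E))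
    have d0 := e0.mfderiv_eq (I := 𝓘(ℝ, E)) (I' := 𝓘(ℝ, E))
    have hα' : ∀ p q : M, p = q → ∀ w : Fin (k + 1) → E, (α p : E [⋀^Fin (k + 1)]→L[ℝ] ℂ) w
      = (α q : E [⋀^Fin (k + 1)]→L[ℝ] ℂ) w := by rintro p q rfl w; rfl
    ext v
    -- At time `0` the homotopy is constant, so every spatial vector is sent to `0`. The degree `k +
    -- 1` provides a slot in which this kills the form.
    have z0 : (ContinuousAlternatingMap.compContinuousLinearMap
        (rawPullback (chartHomotopy E H x) α (0, y)) (ContinuousLinearMap.inr ℝ ℝ E)) v = 0 := by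
      refine (α (chartHomotopy E H x (0, y)) : E [⋀^Fin (k + 1)]→L[ℝ] ℂ).map_coord_zero 0 ?_
      refine (mfderiv_partial_snd (hG 0) (v 0)).trans ((DFunLike.congr_fun d0 (v 0)).trans ?_)
      rw [mfderiv_const]; rfl
    -- At time `1` the homotopy is the identity, so the chart homotopy is the inverse chart and the
    -- pull-back is the chart expression of `α`.
    have z1 : (ContinuousAlternatingMap.compContinuousLinearMap
        (rawPullback (chartHomotopy E H x) α (1, y)) (ContinuousLinearMap.inr ℝ ℝ E)) v =
        chartRep α x y v := by
      refine (hα' _ _ (h1 _ hy.2) _).trans ?_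
      refine congrArg (α ((extChartAt 𝓘(ℝ, E) x).symm y) : E [⋀^Fin (k + 1)]→L[ℝ] ℂ)
        (funext fun i => ?_)
      exact (mfderiv_partial_snd (hG 1) (v i)).trans (DFunLike.congr_fun d1 (v i))
    rw [ContinuousAlternatingMap.sub_apply, z0, z1, sub_zero]
  -- The pull-back of `α` to the cylinder is closed because `d` commutes with pull-backs; on the
  -- normed space `ℝ × E` the operator `rawD` is `extDeriv`.
  · intro p hp
    have hmaps : MapsTo (chartHomotopy E H x) (chartCylinder E W x) W :=
      fun p hp => hW p.1 _ hp.2.2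
    have hc := contMDiffOn_chartHomotopy hH x
    have hp' : p ∈ chartCylinder E W x := hp
    refine (rawD_modelSpace (smoothOn_rawPullback_of_contMDiffOn hc hmaps hα) hp').symm.trans ?_
    refine (rawD_rawPullback_of_contMDiffOn hc hmaps hα hp').trans ?_
    ext v
    exact DFunLike.congr_fun (hd _ (hmaps hp')) _

omit [IsManifold 𝓘(ℝ, E) ∞ M] in
theorem Form.ext {U : Opens M} {α β : Form E U k} (h : ∀ x ∈ U, α.1 x = β.1 x) : α = β :=
  Subtype.ext (funext fun x => by
    by_cases hx : x ∈ U
    · exact h x hx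
    · exact (α.2.1 x hx).trans (β.2.1 x hx).symm)

theorem extD_apply {U : Opens M} (α : Form E U k) {x : M} (hx : x ∈ U) :
    (extD U k α).1 x = rawD α.1 x := cut_of_mem _ hx

omit [IsManifold 𝓘(ℝ, E) ∞ M] in
/-- The form on `U` given by a form that is smooth on `U`. -/
def SmoothOn.toForm {U : Opens M} {α : RawForm E M k} (h : SmoothOn U α) : Form E U k :=
  ⟨cut U α, fun _ hx => cut_of_notMem _ hx, h.congr fun _ hx => (cut_of_mem _ hx).symm⟩

omit [IsManifold 𝓘(ℝ, E) ∞ M] in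
theorem SmoothOn.toForm_apply {U : Opens M} {α : RawForm E M k} (h : SmoothOn U α) {x : M}
    (hx : x ∈ U) : h.toForm.1 x = α x := cut_of_mem _ hx

/-- The Poincaré lemma. -/
theorem SmoothlyContractible.exists_extD_eq {W : Opens M} (hW : SmoothlyContractible E W)
    (α : Form E W (k + 1)) (hα : extD W (k + 1) α = 0) : ∃ β : Form E W k, extD W k β = α := by
  obtain ⟨b₀, -, H, hH, hHW, h0, h1⟩ := hW
  refine ⟨(smoothOn_homotopyOperator hH hHW α.2.2).toForm, Form.ext fun x hx => ?_⟩
  rw [extD_apply _ hx, rawD_congr (fun y hy => SmoothOn.toForm_apply _ hy) hx]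
  refine rawD_homotopyOperator hH hHW α.2.2 h0 h1 (fun y hy => ?_) hx
  rw [← extD_apply _ hy, hα]; rfl

theorem smoothlyContractible_top (E : Type*) [NormedAddCommGroup E] [NormedSpace ℝ E] :
    SmoothlyContractible E (⊤ : Opens E) := by
  refine ⟨0, trivial, fun p => p.1 • p.2, ?_, fun _ _ _ => trivial, fun x _ => zero_smul ℝ x,
    fun x _ => one_smul ℝ x⟩
  exact (contMDiff_fst.smul contMDiff_snd).contMDiffOn

theorem extD_extD {U : Opens M} (α : Form E U k) : extD U (k + 1) (extD U k α) = 0 := by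
  refine Form.ext fun x hx => ?_
  rw [extD_apply _ hx, rawD_congr (fun y hy => extD_apply α hy) hx]
  apply eq_of_chartRep
  have hy : extChartAt 𝓘(ℝ, E) x x ∈ chartDom E U x := mem_chartDom_self hx
  have hs := smoothOn_rawD α.2.2
  rw [chartRep_rawD hs x hy, (Filter.eventuallyEq_of_mem ((isOpen_chartDom U x).mem_nhds hy)
    (chartRep_rawD α.2.2 x)).extDeriv_eq, extDeriv_extDeriv_apply
      ((α.2.2 x).contDiffAt ((isOpen_chartDom U x).mem_nhds hy)) two_le_infty]
  rfl

end Poincare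

/-! ### Combinatorics of ordered tuples: inserting an index -/

section Insertion
variable {Λ V : Type*} [LinearOrder Λ] [AddCommGroup V] [Module ℂ V]

theorem range_face {p : ℕ} (t : Fin (p + 2) ↪o Λ) (j : Fin (p + 2)) :
    range (face t j) = range t \ {t j} := by
  ext x
  constructor
  · rintro ⟨i, rfl⟩
    exact ⟨⟨_, rfl⟩, fun h => j.succAbove_ne i (t.injective h)⟩
  · rintro ⟨⟨i, rfl⟩, h⟩
    obtain ⟨i, rfl⟩ := Fin.exists_succAbove_eq (x := i) (y := j) (by rintro rfl; exact h rfl)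
    exact ⟨i, rfl⟩

/-- A strictly increasing tuple is determined by its range, and the range is recovered from the face
and the omitted entry. -/
theorem eq_of_face_eq {p : ℕ} {t t' : Fin (p + 2) ↪o Λ} {j j' : Fin (p + 2)}
    (h : t j = t' j') (hf : face t j = face t' j') : t = t' ∧ j = j' := by
  have hr : range t = range t' := by
    have h1 := range_face t j
    rw [hf, range_face, h] at h1
    have h2 : t' j' ∈ range t := ⟨j, h⟩
    have h3 := congrArg (insert (t' j')) h1
    rwa [insert_sdiff_singleton, insert_sdiff_singleton, insert_eq_of_mem (mem_range_self j'),
      insert_eq_of_mem h2, eq_comm] at h3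
  obtain rfl := OrderEmbedding.range_inj.1 hr
  exact ⟨rfl, t.injective h⟩

theorem exists_insertion {p : ℕ} (s : Fin (p + 1) ↪o Λ) {l : Λ} (hl : l ∉ range s) :
    ∃ (t : Fin (p + 2) ↪o Λ) (j : Fin (p + 2)), t j = l ∧ face t j = s := by
  classical
  have hl' : l ∉ Finset.univ.image s := by simpa using hl
  have hc : (insert l (Finset.univ.image s)).card = p + 2 := by
    rw [Finset.card_insert_of_notMem hl', Finset.card_image_of_injective _ s.injective]
    simp
  have hr := Finset.range_orderEmbOfFin _ hc
  obtain ⟨j, hj⟩ : l ∈ range (Finset.orderEmbOfFin _ hc) := by rw [hr]; simp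
  refine ⟨Finset.orderEmbOfFin _ hc, j, hj, OrderEmbedding.range_inj.1 ?_⟩
  rw [range_face, hr, hj]
  simpa using hl

open Classical in
/-- The operator `(Kc)_{λ₀…λₚ} = c_{λλ₀…λₚ}` on alternating cochains, in terms of ordered tuples. -/
def cone {p : ℕ} (l : Λ) (c : (Fin (p + 2) ↪o Λ) → V) (s : Fin (p + 1) ↪o Λ) : V :=
  if h : ∃ (t : Fin (p + 2) ↪o Λ) (j : Fin (p + 2)), t j = l ∧ face t j = s then
    (-1 : ℂ) ^ (h.choose_spec.choose : ℕ) • c h.choose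
  else 0

/-- The sign is that of moving the entry in place `j` to the front. By `eq_of_face_eq` the pair
chosen in `cone` can only be `(t, j)`. -/
theorem cone_face {p : ℕ} (c : (Fin (p + 2) ↪o Λ) → V) (t : Fin (p + 2) ↪o Λ) (j : Fin (p + 2)) :
    cone (t j) c (face t j) = (-1 : ℂ) ^ (j : ℕ) • c t := by
  have h : ∃ (t' : Fin (p + 2) ↪o Λ) (j' : Fin (p + 2)), t' j' = t j ∧ face t' j' = face t j :=
    ⟨t, j, rfl, rfl⟩
  obtain ⟨h1, h2⟩ := eq_of_face_eq h.choose_spec.choose_spec.1 h.choose_spec.choose_spec.2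
  rw [cone, dif_pos h, h2, h1]

theorem cone_of_mem {p : ℕ} {l : Λ} (c : (Fin (p + 2) ↪o Λ) → V) {s : Fin (p + 1) ↪o Λ}
    (h : l ∈ range s) : cone l c s = 0 := by
  refine dif_neg ?_
  rintro ⟨t, j, rfl, rfl⟩
  rw [range_face] at h
  exact h.2 rfl

/-- The operators `cone l` are contracting homotopies. -/
theorem sum_cone_face {p : ℕ} (l : Λ) (c : (Fin (p + 2) ↪o Λ) → V) (s : Fin (p + 2) ↪o Λ)
    (hc : ∀ (t : Fin (p + 3) ↪o Λ) (j : Fin (p + 3)), t j = l → face t j = s →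
      ∑ i : Fin (p + 3), (-1 : ℂ) ^ (i : ℕ) • c (face t i) = 0) :
    ∑ i : Fin (p + 2), (-1 : ℂ) ^ (i : ℕ) • cone l c (face s i) = c s := by
  by_cases hl : l ∈ range s
  · obtain ⟨j, rfl⟩ := hl
    -- Only the face that omits `l` avoids a repeated index; there the sign of `cone` cancels the
    -- sign of the face.
    rw [Finset.sum_eq_single j, cone_face, smul_smul, ← mul_pow]
    · simp
    · intro i _ hi
      rw [cone_of_mem, smul_zero]
      rw [range_face]
      exact ⟨⟨j, rfl⟩, fun h => hi (s.injective h).symm⟩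
    · simp
  · obtain ⟨t, j, rfl, rfl⟩ := exists_insertion s hl
    have h := hc t j rfl rfl
    -- With `t` equal to `s` with `l` inserted in place `j`, the cocycle identity on `t` is solved
    -- for its term `face t j = s`.
    rw [Fin.sum_univ_succAbove _ j, add_eq_zero_iff_eq_neg, ← Finset.sum_neg_distrib] at h
    have h2 : c (face t j) = (-1 : ℂ) ^ (j : ℕ) • (-1 : ℂ) ^ (j : ℕ) • c (face t j) := by
      rw [smul_smul, ← mul_pow]; simp
    rw [h2, h, Finset.smul_sum]
    refine Finset.sum_congr rfl fun i _ => ?_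
    -- Two entries may be removed in either order. Removing the other entry first exhibits this
    -- double face as one to which `cone_face` applies.
    have h3 : face (face t j) i = face (face t (j.succAbove i)) (i.predAbove j) := by
      ext x
      exact congrArg t (Fin.succAbove_succAbove_succAbove_predAbove j i x).symm
    have h4 : t j = face t (j.succAbove i) (i.predAbove j) :=
      congrArg t (Fin.succAbove_succAbove_predAbove j i).symm
    rw [h3, h4, cone_face, smul_neg, smul_smul, smul_smul, ← neg_smul]
    congr 1
    have h5 := Fin.neg_one_pow_succAbove_add_predAbove (R := ℂ) j i
    rw [pow_add, pow_add] at h5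
    have h6 : ((-1 : ℂ) ^ ((i.predAbove j : Fin _) : ℕ)) * (-1) ^ ((i.predAbove j : Fin _) : ℕ) = 1 := by
      rw [← mul_pow]; simp
    have h7 : ((-1 : ℂ) ^ (j : ℕ)) * (-1) ^ (j : ℕ) = 1 := by
      rw [← mul_pow]; simp
    linear_combination ((-1 : ℂ) ^ (j : ℕ) * (-1) ^ ((i.predAbove j : Fin _) : ℕ)) * h5 -
      (-1 : ℂ) ^ (j : ℕ) * (-1) ^ ((j.succAbove i : Fin _) : ℕ) * h6 -
      (-1 : ℂ) ^ (i : ℕ) * (-1) ^ ((i.predAbove j : Fin _) : ℕ) * h7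

/-- An average of contracting homotopies is again one. The cocycle identity is demanded only for
insertions of members of `S`: at a point `x`, a Čech cocycle satisfies it only on tuples whose
intersection contains `x`. -/
theorem sum_smul_cone_face [Module ℝ V] [SMulCommClass ℂ ℝ V] {p : ℕ} (S : Finset Λ) (w : Λ → ℝ)
    (hw : ∑ l ∈ S, w l = 1) (c : (Fin (p + 2) ↪o Λ) → V) (s : Fin (p + 2) ↪o Λ)
    (hc : ∀ (t : Fin (p + 3) ↪o Λ) (j : Fin (p + 3)), t j ∈ S → face t j = s →
      ∑ i : Fin (p + 3), (-1 : ℂ) ^ (i : ℕ) • c (face t i) = 0) :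
    ∑ i : Fin (p + 2), (-1 : ℂ) ^ (i : ℕ) • ∑ l ∈ S, w l • cone l c (face s i) = c s := by
  simp only [Finset.smul_sum]
  rw [Finset.sum_comm]
  have h : ∑ l ∈ S, w l • c s = c s := by rw [← Finset.sum_smul, hw, one_smul]
  refine Eq.trans (Finset.sum_congr rfl fun l hl => ?_) h
  rw [← sum_cone_face l c s (by rintro t j rfl h; exact hc t j hl h), Finset.smul_sum]
  exact Finset.sum_congr rfl fun i _ => smul_comm _ _ _

end Insertion

/-! ### Local criteria for smoothness and multiplication by functions -/

section Local
variable {E M : Type*} [NormedAddCommGroup E] [NormedSpace ℝ E]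
  [TopologicalSpace M] [ChartedSpace E M] {k : ℕ}

theorem smul_alternating_eq_zero {r : ℝ} (h : r = 0) (a : E [⋀^Fin k]→L[ℝ] ℂ) : r • a = 0 := by
  ext v
  simp [h]

theorem SmoothOn.of_locally {W : Opens M} {α : RawForm E M k}
    (h : ∀ x ∈ W, ∃ O : Opens M, x ∈ O ∧ SmoothOn O α) : SmoothOn W α := fun x₀ y hy => by
  obtain ⟨O, hO, hs⟩ := h _ hy.2
  exact ((hs x₀).contDiffAt ((isOpen_chartDom O x₀).mem_nhds ⟨hy.1, hO⟩)).contDiffWithinAt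

theorem smoothOn_zero (W : Opens M) : SmoothOn W (0 : RawForm E M k) := fun _ =>
  contDiffOn_const (c := 0)

theorem SmoothOn.sum {ι : Type*} {W : Opens M} {α : ι → RawForm E M k} (S : Finset ι)
    (h : ∀ i ∈ S, SmoothOn W (α i)) : SmoothOn W (∑ i ∈ S, α i) :=
  Finset.sum_induction _ (SmoothOn W) (fun _ _ ha hb x₀ => (ha x₀).add (hb x₀))
    (smoothOn_zero W) h

/-- Near each point only finitely many summands are nonzero, so the sum is locally a finite one. -/
theorem SmoothOn.finsum {ι : Type*} {W : Opens M} {α : ι → RawForm E M k}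
    (h : ∀ i, SmoothOn W (α i)) {S : ι → Set M} (hS : LocallyFinite S)
    (hα : ∀ i, ∀ x ∉ S i, α i x = 0) : SmoothOn W fun x => ∑ᶠ i, α i x := by
  refine SmoothOn.of_locally fun x hx => ?_
  obtain ⟨O, hO, hfin⟩ := hS x
  let O' : Opens M := ⟨interior O, isOpen_interior⟩
  refine ⟨W ⊓ O', ⟨hx, mem_interior_iff_mem_nhds.2 hO⟩,
    ((SmoothOn.sum hfin.toFinset fun i _ => h i).mono inf_le_left).congr fun y hy => ?_⟩
  rw [Finset.sum_apply]
  refine (finsum_eq_sum_of_support_subset _ fun i hi => ?_).symm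
  rw [Finite.coe_toFinset]
  refine ⟨y, ?_, interior_subset hy.2⟩
  by_contra hy'
  exact hi (hα i y hy')

variable [IsManifold 𝓘(ℝ, E) ∞ M]

theorem SmoothOn.smul {W : Opens M} {α : RawForm E M k} (h : SmoothOn W α)
    (f : C^∞⟮𝓘(ℝ, E), M; 𝓘(ℝ), ℝ⟯) : SmoothOn W (fun x => f x • α x : RawForm E M k) := by
  intro x₀
  have h1 : ContMDiffOn 𝓘(ℝ, E) 𝓘(ℝ, ℝ) ∞ (f ∘ (extChartAt 𝓘(ℝ, E) x₀).symm) (chartDom E W x₀) :=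
    (f.contMDiff.comp_contMDiffOn (contMDiffOn_extChartAt_symm x₀)).mono inter_subset_left
  exact h1.contDiffOn.smul (h x₀)

/-- Extension by zero: `W` is covered by `W ⊓ O`, where `α` is smooth, and the complement of the
support of `f`, where the product vanishes. -/
theorem SmoothOn.smul_of_tsupport_subset {W O : Opens M} {α : RawForm E M k}
    (h : SmoothOn (W ⊓ O) α) (f : C^∞⟮𝓘(ℝ, E), M; 𝓘(ℝ), ℝ⟯) (hf : tsupport f ⊆ O) :
    SmoothOn W (fun x => f x • α x : RawForm E M k) := by
  refine SmoothOn.of_locally fun x hx => ?_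
  by_cases hO : x ∈ O
  · exact ⟨W ⊓ O, ⟨hx, hO⟩, h.smul f⟩
  · let O' : Opens M := ⟨(tsupport f)ᶜ, (isClosed_tsupport f).isOpen_compl⟩
    refine ⟨O', fun hx' => hO (hf hx'), (smoothOn_zero O').congr fun y hy => ?_⟩
    exact (smul_alternating_eq_zero (image_eq_zero_of_notMem_tsupport hy) _).symm

end Local

/-! ### Exactness of the rows of the double complex -/

section Cech
variable {E B Λ : Type*} [NormedAddCommGroup E] [NormedSpace ℝ E]
  [TopologicalSpace B] [ChartedSpace E B] [LinearOrder Λ]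

/-- The value of a form at a point, as a linear map. -/
def evalForm {U : Opens B} {k : ℕ} (x : B) : Form E U k →ₗ[ℂ] E [⋀^Fin k]→L[ℝ] ℂ where
  toFun α := α.1 x
  map_add' _ _ := rfl
  map_smul' _ _ := rfl

theorem restrictForm_apply {U W : Opens B} (h : W ≤ U) {k : ℕ} (α : Form E U k) {x : B}
    (hx : x ∈ W) : (restrictForm h k α).1 x = α.1 x := cut_of_mem _ hx

theorem mem_interU {U : Λ → Opens B} {p : ℕ} {s : Fin (p + 1) ↪o Λ} {x : B} :
    x ∈ interU U s ↔ ∀ i, x ∈ U (s i) := mem_iInter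

theorem cechδ_apply {U : Λ → Opens B} {p q : ℕ} (c : Cochain E U p q) (s : Fin (p + 2) ↪o Λ) {x : B}
    (hx : x ∈ interU U s) : (cechδ U p q c s).1 x =
      ∑ i : Fin (p + 2), (-1 : ℂ) ^ (i : ℕ) • (c (face s i)).1 x := by
  have h : cechδ U p q c s = ∑ i : Fin (p + 2),
    (-1 : ℂ) ^ (i : ℕ) • restrictForm (interU_le_face U s i) q (c (face s i)) := by
    simp [cechδ]
  rw [h]
  refine (map_sum (evalForm x) _ _).trans (Finset.sum_congr rfl fun i _ => ?_)
  rw [map_smul]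
  exact congrArg _ (restrictForm_apply (interU_le_face U s i) _ hx)

variable [IsManifold 𝓘(ℝ, E) ∞ B]

theorem mem_interU_of_face {U : Λ → Opens B} {p : ℕ} {t : Fin (p + 2) ↪o Λ} {j : Fin (p + 2)} {x : B}
    (h : x ∈ interU U (face t j)) (hj : x ∈ U (t j)) : x ∈ interU U t := by
  refine mem_interU.2 fun i => ?_
  by_cases hi : i = j
  · rwa [hi]
  · obtain ⟨i, rfl⟩ := Fin.exists_succAbove_eq hi
    exact mem_interU.1 h i

/-- The form `c_{l s}` lives only on `U_l ∩ U_s`. Multiplied by a function supported in `U_l` it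
extends by zero to all of `U_s`. -/
theorem smoothOn_smul_cone {U : Λ → Opens B} {p q : ℕ} (c : Cochain E U (p + 1) q) (l : Λ)
    (f : C^∞⟮𝓘(ℝ, E), B; 𝓘(ℝ), ℝ⟯) (hf : tsupport f ⊆ U l) (s : Fin (p + 1) ↪o Λ) :
    SmoothOn (interU U s)
      (fun x => f x • cone l (fun t => (c t).1 x) s : RawForm E B q) := by
  by_cases hl : l ∈ range s
  · refine (smoothOn_zero _).congr fun x _ => ?_
    rw [cone_of_mem _ hl, smul_zero]; rfl
  · obtain ⟨t, j, rfl, rfl⟩ := exists_insertion s hl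
    refine SmoothOn.smul_of_tsupport_subset (O := U (t j)) ?_ f hf
    refine SmoothOn.mono (U := interU U t) ?_ fun x hx => mem_interU_of_face hx.1 hx.2
    refine SmoothOn.congr (((-1 : ℂ) ^ (j : ℕ)) • c t).2.2 fun x _ => ?_
    exact (cone_face (fun t => (c t).1 x) t j).symm

/-- In the presence of a partition of unity the rows of the Čech-de Rham complex are exact. -/
theorem exists_cechδ_eq {U : Λ → Opens B} (ρ : SmoothPartitionOfUnity Λ 𝓘(ℝ, E) B univ)
    (hρ : ρ.IsSubordinate fun l => (U l : Set B)) {p q : ℕ} (c : Cochain E U (p + 1) q)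
    (hc : cechδ U (p + 1) q c = 0) : ∃ b : Cochain E U p q, cechδ U p q b = c := by
  -- The primitive is `b_s = ∑ ρ_l c_{l s}`, summed over `l`.
  have hs : ∀ s : Fin (p + 1) ↪o Λ, SmoothOn (interU U s)
      (fun x => ∑ᶠ l, ρ l x • cone l (fun t => (c t).1 x) s : RawForm E B q) := fun s =>
    SmoothOn.finsum (fun l => smoothOn_smul_cone c l (ρ l) (hρ l) s) ρ.locallyFinite
      fun l x hx => smul_alternating_eq_zero (Function.notMem_support.1 hx) _
  refine ⟨fun s => (hs s).toForm, funext fun s => Form.ext fun x hx => ?_⟩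
  rw [cechδ_apply _ _ hx]
  have hfin : (Function.support fun l => ρ l x).Finite := ρ.locallyFinite.point_finite x
  have hsum : ∑ l ∈ hfin.toFinset, ρ l x = 1 := by
    rw [← ρ.sum_eq_one (mem_univ x)]
    exact (finsum_eq_sum_of_support_subset _ (by simp)).symm
  -- At a fixed point the claim is algebra: `S` consists of the finitely many `l` with `ρ_l(x) ≠ 0`.
  refine Eq.trans (Finset.sum_congr rfl fun i _ => congrArg _ ?_)
    (sum_smul_cone_face hfin.toFinset (fun l => ρ l x) hsum
      (fun t => ((c t).1 x : E [⋀^Fin q]→L[ℝ] ℂ)) s ?_)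
  · refine (SmoothOn.toForm_apply _ (interU_le_face U s i hx)).trans ?_
    refine finsum_eq_sum_of_support_subset _ fun l hl => ?_
    rw [Finite.coe_toFinset]
    exact fun h0 => hl (smul_alternating_eq_zero h0 _)
  -- Here `ρ_l(x) ≠ 0` forces `x ∈ U_l`, so `x` lies in the intersection of the enlarged tuple,
  -- where `δc = 0` can be evaluated.
  · rintro t j hl rfl
    rw [← cechδ_apply c t (mem_interU_of_face hx (hρ _ (subset_tsupport _ (hfin.mem_toFinset.1 hl)))),
      hc]
    rfl

end Cech

/-! ### The relation `δ² = 0` for ordered tuples -/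

section FaceSum
variable {Λ V : Type*} [LinearOrder Λ] [AddCommGroup V] [Module ℂ V]

/-- The involution exchanges the order in which two entries are omitted. It preserves the double
face, reverses the sign and has no fixed point because `i.succAbove j ≠ i`. -/
theorem sum_face_face {p : ℕ} (c : (Fin (p + 1) ↪o Λ) → V) (s : Fin (p + 3) ↪o Λ) :
    ∑ i : Fin (p + 3), (-1 : ℂ) ^ (i : ℕ) •
      ∑ j : Fin (p + 2), (-1 : ℂ) ^ (j : ℕ) • c (face (face s i) j) = 0 := by
  simp only [Finset.smul_sum, smul_smul, ← pow_add]
  rw [← Finset.sum_product']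
  refine Finset.sum_involution (fun a _ => (a.1.succAbove a.2, a.2.predAbove a.1)) ?_ ?_ ?_ ?_
  · rintro ⟨i, j⟩ -
    have h : face (face s (i.succAbove j)) (j.predAbove i) = face (face s i) j := by
      ext x
      exact congrArg s (Fin.succAbove_succAbove_succAbove_predAbove i j x)
    change _ + (-1 : ℂ) ^ (((i.succAbove j : Fin _) : ℕ) + ((j.predAbove i : Fin _) : ℕ)) •
      c (face (face s (i.succAbove j)) (j.predAbove i)) = 0
    rw [Fin.neg_one_pow_succAbove_add_predAbove, h, neg_smul, add_neg_cancel]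
  · rintro ⟨i, j⟩ - - h
    exact i.succAbove_ne j (congrArg Prod.fst h)
  · simp
  · rintro ⟨i, j⟩ -
    exact Prod.ext (Fin.succAbove_succAbove_predAbove i j) (Fin.predAbove_predAbove_succAbove i j)

end FaceSum

/-! ### The total complex and the zig-zag argument -/

section TotalComplex
variable {E B Λ : Type*} [NormedAddCommGroup E] [NormedSpace ℝ E]
  [TopologicalSpace B] [ChartedSpace E B] [LinearOrder Λ] [IsManifold 𝓘(ℝ, E) ∞ B]
  {U : Λ → Opens B}

theorem cechδ_cechδ {p q : ℕ} (c : Cochain E U p q) : cechδ U (p + 1) q (cechδ U p q c) = 0 := by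
  refine funext fun s => Form.ext fun x hx => ?_
  rw [cechδ_apply _ _ hx]
  refine Eq.trans (Finset.sum_congr rfl fun i _ => congrArg _ ?_)
    (sum_face_face (fun t => ((c t).1 x : E [⋀^Fin q]→L[ℝ] ℂ)) s)
  exact cechδ_apply c _ (interU_le_face U s i hx)

theorem cechD_cechD {p q : ℕ} (c : Cochain E U p q) : cechD U p (q + 1) (cechD U p q c) = 0 :=
  funext fun s => extD_extD (c s)

theorem cechD_cechδ {p q : ℕ} (c : Cochain E U p q) :
    cechD U (p + 1) q (cechδ U p q c) = cechδ U p (q + 1) (cechD U p q c) := by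
  funext s
  simp [cechD, cechδ, extD_restrictForm]

theorem single_apply_same {n p q : ℕ} (h : p + q = n) (c : Cochain E U p q) :
    (single U p q h c).1 p q = c := by
  change Pi.single (M := fun p => ∀ q : ℕ, Cochain E U p q) p
    (Pi.single (M := fun q => Cochain E U p q) q c) p q = c
  rw [Pi.single_eq_same, Pi.single_eq_same]

theorem single_apply_ne {n p q p' q' : ℕ} (h : p + q = n) (c : Cochain E U p q)
    (h' : p' = p → q' ≠ q) : (single U p q h c).1 p' q' = 0 := by
  change Pi.single (M := fun p => ∀ q : ℕ, Cochain E U p q) p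
    (Pi.single (M := fun q => Cochain E U p q) q c) p' q' = 0
  by_cases hp : p' = p
  · subst hp
    rw [Pi.single_eq_same, Pi.single_eq_of_ne (h' rfl)]
  · rw [Pi.single_eq_of_ne hp]; rfl

theorem totalD_zero_succ {n : ℕ} (c : Total E U n) (q : ℕ) :
    (totalD U n c).1 0 (q + 1) = cechD U 0 q (c.1 0 q) := rfl

theorem totalD_succ_zero {n : ℕ} (c : Total E U n) (p : ℕ) :
    (totalD U n c).1 (p + 1) 0 = cechδ U p 0 (c.1 p 0) := rfl

theorem totalD_succ_succ {n : ℕ} (c : Total E U n) (p q : ℕ) :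
    (totalD U n c).1 (p + 1) (q + 1) = cechδ U p (q + 1) (c.1 p (q + 1)) +
      (-1 : ℂ) ^ (p + 1) • cechD U (p + 1) q (c.1 (p + 1) q) := rfl

theorem totalD_single {n p q : ℕ} (h : p + q = n) (c : Cochain E U p q) :
    totalD U n (single U p q h c) =
      single U (p + 1) q (by omega) (cechδ U p q c) +
        (-1 : ℂ) ^ p • single U p (q + 1) (by omega) (cechD U p q c) := by
  refine Subtype.ext (funext fun a => funext fun b => ?_)
  change _ = (single U (p + 1) q _ (cechδ U p q c)).1 a b +
    (-1 : ℂ) ^ p • (single U p (q + 1) _ (cechD U p q c)).1 a b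
  rcases a with _ | a
  · rw [single_apply_ne (p' := 0) (p := p + 1) _ _ (by omega), zero_add]
    rcases b with _ | b
    · rw [single_apply_ne (q' := 0) (q := q + 1) _ _ (by omega), smul_zero]
      rfl
    · rw [totalD_zero_succ]
      by_cases hpq : 0 = p ∧ b = q
      · obtain ⟨rfl, rfl⟩ := hpq
        simp only [single_apply_same, pow_zero, one_smul]
      · rw [single_apply_ne _ _ (by omega), single_apply_ne _ _ (by omega), map_zero, smul_zero]
  · rcases b with _ | b
    · rw [totalD_succ_zero, single_apply_ne (q' := 0) (q := q + 1) _ _ (by omega), smul_zero,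
        add_zero]
      by_cases hpq : a = p ∧ 0 = q
      · obtain ⟨rfl, rfl⟩ := hpq
        simp only [single_apply_same]
      · rw [single_apply_ne _ _ (by omega), single_apply_ne _ _ (by omega), map_zero]
    · rw [totalD_succ_succ]
      congr 1
      · by_cases hpq : a = p ∧ b + 1 = q
        · obtain ⟨rfl, rfl⟩ := hpq
          simp only [single_apply_same]
        · rw [single_apply_ne _ _ (by omega), single_apply_ne _ _ (by omega), map_zero]
      · by_cases hpq : a + 1 = p ∧ b = q
        · obtain ⟨rfl, rfl⟩ := hpq
          simp only [single_apply_same]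
        · rw [single_apply_ne _ _ (by omega), single_apply_ne _ _ (by omega), map_zero,
            smul_zero, smul_zero]

/-- `δ` and `d` commute, and the sign `(-1)ᵖ` changes when `δ` raises `p`, so the mixed terms
cancel. -/
theorem totalD_totalD_single {n p q : ℕ} (h : p + q = n) (c : Cochain E U p q) :
    totalD U (n + 1) (totalD U n (single U p q h c)) = 0 := by
  rw [totalD_single, map_add, map_smul, totalD_single, totalD_single, cechδ_cechδ, cechD_cechD,
    cechD_cechδ, map_zero, map_zero, smul_zero, add_zero, zero_add, ← add_smul, pow_succ]
  simp

theorem totalD_single_eq_zero {n p q : ℕ} (h : p + q = n) {c : Cochain E U p q}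
    (h1 : cechδ U p q c = 0) (h2 : cechD U p q c = 0) : totalD U n (single U p q h c) = 0 := by
  rw [totalD_single, h1, h2, map_zero, map_zero, smul_zero, add_zero]

theorem cechδ_eq_zero_of_totalD_single {n p q : ℕ} (h : p + q = n) {c : Cochain E U p q}
    (hc : totalD U n (single U p q h c) = 0) : cechδ U p q c = 0 := by
  have h1 := congrFun (congrFun (congrArg Subtype.val hc) (p + 1)) q
  rw [totalD_single] at h1
  change (single U (p + 1) q _ (cechδ U p q c)).1 _ _ +
    (-1 : ℂ) ^ p • (single U p (q + 1) _ (cechD U p q c)).1 _ _ = 0 at h1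
  rwa [single_apply_same, single_apply_ne _ _ (by omega), smul_zero, add_zero] at h1

theorem cechD_eq_zero_of_totalD_single {n p q : ℕ} (h : p + q = n) {c : Cochain E U p q}
    (hc : totalD U n (single U p q h c) = 0) : cechD U p q c = 0 := by
  have h1 := congrFun (congrFun (congrArg Subtype.val hc) p) (q + 1)
  rw [totalD_single] at h1
  change (single U (p + 1) q _ (cechδ U p q c)).1 _ _ +
    (-1 : ℂ) ^ p • (single U p (q + 1) _ (cechD U p q c)).1 _ _ = 0 at h1
  rw [single_apply_same, single_apply_ne _ _ (by omega), zero_add] at h1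
  exact (smul_eq_zero.1 h1).resolve_left (by simp)

/-- If the rows are exact, a coboundary of bidegree `(0, k + 1)` is the coboundary of a cochain of
bidegree `(0, k)`. -/
theorem exists_cechD_eq_of_totalD_eq_single
    (hex : ∀ (p q : ℕ) (c : Cochain E U (p + 1) q), cechδ U (p + 1) q c = 0 →
      ∃ b : Cochain E U p q, cechδ U p q b = c)
    {k : ℕ} {γ : Cochain E U 0 (k + 1)} (c : Total E U k)
    (hc : totalD U k c = single U 0 (k + 1) (Nat.zero_add _) γ) :
    ∃ b : Cochain E U 0 k, cechδ U 0 k b = 0 ∧ cechD U 0 k b = γ := by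
  -- Induction on a bound `m` for the Čech degrees that occur in the primitive `c`; its total degree
  -- `k` is such a bound.
  suffices H : ∀ (m : ℕ) (c : Total E U k),
      totalD U k c = single U 0 (k + 1) (Nat.zero_add _) γ → (∀ p q, m < p → c.1 p q = 0) →
      ∃ b : Cochain E U 0 k, cechδ U 0 k b = 0 ∧ cechD U 0 k b = γ from
    H k c hc fun p q hp => c.2 p q (by omega)
  -- The part of `c` in the last column `m` is `δ`-closed: in column `m + 1` the coboundary `γ` has
  -- no component, and `c` contributes nothing else there.
  have row : ∀ (m : ℕ) (c : Total E U k),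
      totalD U k c = single U 0 (k + 1) (Nat.zero_add _) γ → (∀ p q, m < p → c.1 p q = 0) →
      ∀ q, cechδ U m q (c.1 m q) = 0 := by
    intro m c hc hm q
    have h1 := congrFun (congrFun (congrArg Subtype.val hc) (m + 1)) q
    rw [single_apply_ne _ _ (by omega)] at h1
    rcases q with _ | q
    · exact h1
    · rwa [totalD_succ_succ, hm _ _ (Nat.lt_succ_self m), map_zero, smul_zero, add_zero] at h1
  intro m
  induction m with
  | zero =>
    intro c hc hm
    refine ⟨c.1 0 k, row 0 c hc hm k, ?_⟩
    have h1 := congrFun (congrFun (congrArg Subtype.val hc) 0) (k + 1)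
    rwa [single_apply_same] at h1
  | succ m ih =>
    intro c hc hm
    by_cases hmk : m + 1 ≤ k
    · obtain ⟨q, rfl⟩ := Nat.exists_eq_add_of_le hmk
      -- The last component is `δe`. Subtracting the total coboundary `z` of `e` clears column `m +
      -- 1` and leaves the coboundary of `c` unchanged.
      obtain ⟨e, he⟩ := hex m q (c.1 (m + 1) q) (row (m + 1) c hc hm q)
      have hq : m + q + 1 = m + 1 + q := by omega
      -- The properties of `z` are stated existentially so that its degree `m + q + 1` can be
      -- rewritten as `m + 1 + q`.
      obtain ⟨z, hz, hz1, hz2⟩ : ∃ z : Total E U (m + 1 + q), totalD U (m + 1 + q) z = 0 ∧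
          z.1 (m + 1) q = cechδ U m q e ∧ ∀ p q, m + 1 < p → z.1 p q = 0 := by
        rw [← hq]
        refine ⟨totalD U (m + q) (single U m q rfl e), totalD_totalD_single rfl e, ?_, ?_⟩
        · rw [totalD_single]
          change (single U (m + 1) q _ (cechδ U m q e)).1 _ _ +
            (-1 : ℂ) ^ m • (single U m (q + 1) _ (cechD U m q e)).1 _ _ = _
          rw [single_apply_same, single_apply_ne _ _ (by omega), smul_zero, add_zero]
        · intro a b hab
          rw [totalD_single]
          change (single U (m + 1) q _ (cechδ U m q e)).1 _ _ +
            (-1 : ℂ) ^ m • (single U m (q + 1) _ (cechD U m q e)).1 _ _ = _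
          rw [single_apply_ne _ _ (by omega), single_apply_ne _ _ (by omega), smul_zero, add_zero]
      refine ih (c - z) (by rw [map_sub, hz, sub_zero, hc]) fun p q' hp => ?_
      change c.1 p q' - z.1 p q' = 0
      by_cases hp' : m + 1 < p
      · rw [hm p q' hp', hz2 p q' hp', sub_zero]
      · obtain rfl : p = m + 1 := by omega
        by_cases hq' : q' = q
        · rw [hq', hz1, he, sub_self]
        · rw [c.2 _ _ (by omega), z.2 _ _ (by omega), sub_zero]
    · exact ih c hc fun p q hp => by
        by_cases h : m + 1 < p
        · exact hm p q h
        · exact c.2 p q (by omega)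

end TotalComplex

/-! ### Gluing of forms; families on the members of the covering -/

section Gluing
variable {E B : Type*} [NormedAddCommGroup E] [NormedSpace ℝ E]
  [TopologicalSpace B] [ChartedSpace E B] {k : ℕ}

/-- Forms that agree on the overlaps of an open covering are the restrictions of a form. -/
theorem exists_form_of_agree {ι : Type*} {O : ι → Opens B} (hO : ∀ b, ∃ i, b ∈ O i)
    (β : ∀ i, Form E (O i) k)
    (h : ∀ i j, ∀ x ∈ O i, x ∈ O j → (β i).1 x = (β j).1 x) :
    ∃ η : Form E (⊤ : Opens B) k, ∀ i, ∀ x ∈ O i, η.1 x = (β i).1 x := by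
  choose i hi using hO
  have hη : ∀ j, ∀ x ∈ O j, (fun x => (β (i x)).1 x : RawForm E B k) x = (β j).1 x :=
    fun j x hx => h _ _ _ (hi x) hx
  exact ⟨⟨fun x => (β (i x)).1 x, fun x hx => absurd trivial hx,
    SmoothOn.of_locally fun x _ => ⟨O (i x), hi x, (β (i x)).2.2.congr fun y hy =>
      (hη _ y hy).symm⟩⟩, hη⟩

variable {Λ : Type*} [LinearOrder Λ] {U : Λ → Opens B}

/-- The restrictions of a form to the members of a covering. -/
def restrictFamily (U : Λ → Opens B) (k : ℕ) : Form E (⊤ : Opens B) k →ₗ[ℂ] ∀ l, Form E (U l) k :=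
  LinearMap.pi fun _ => restrictForm le_top k

theorem restrictFamily_apply (η : Form E (⊤ : Opens B) k) {l : Λ} {x : B} (hx : x ∈ U l) :
    (restrictFamily U k η l).1 x = η.1 x := restrictForm_apply (le_top : U l ≤ ⊤) η hx

theorem ofFamily_apply (β : ∀ l, Form E (U l) k) (s : Fin 1 ↪o Λ) {x : B} (hx : x ∈ interU U s) :
    (ofFamily U k β s).1 x = (β (s 0)).1 x := restrictForm_apply (interU_le U s 0) _ hx

theorem cechδ_zero_apply (c : Cochain E U 0 k) (s : Fin 2 ↪o Λ) {x : B} (hx : x ∈ interU U s) :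
    (cechδ U 0 k c s).1 x = (c (face s 0)).1 x - (c (face s 1)).1 x := by
  rw [cechδ_apply c s hx, Fin.sum_univ_two, sub_eq_add_neg]
  exact congrArg₂ (· + ·) (by simp) (by ext v; simp)

theorem cechδ_ofFamily_eq_zero {β : ∀ l, Form E (U l) k}
    (h : ∀ l m, ∀ x ∈ U l, x ∈ U m → (β l).1 x = (β m).1 x) :
    cechδ U 0 k (ofFamily U k β) = 0 := by
  refine funext fun s => Form.ext fun x hx => ?_
  have h0 := interU_le_face U s 0 hx
  have h1 := interU_le_face U s 1 hx
  rw [cechδ_zero_apply _ s hx, ofFamily_apply β _ h0, ofFamily_apply β _ h1,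
    h _ _ x (interU_le U _ 0 h0) (interU_le U _ 0 h1), sub_self]
  rfl

theorem cechδ_ofFamily_restrictFamily (η : Form E (⊤ : Opens B) k) :
    cechδ U 0 k (ofFamily U k (restrictFamily U k η)) = 0 :=
  cechδ_ofFamily_eq_zero fun l m x hl hm => by
    rw [restrictFamily_apply η hl, restrictFamily_apply η hm]

variable (Λ) in
/-- One-element tuples. -/
def vertex (l : Λ) : Fin 1 ↪o Λ := OrderEmbedding.ofStrictMono (fun _ => l) fun i j h =>
  absurd h (by simp [Subsingleton.elim i j])

theorem mem_interU_vertex {l : Λ} {x : B} : x ∈ interU U (vertex Λ l) ↔ x ∈ U l :=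
  ⟨fun h => mem_interU.1 h 0, fun h => mem_interU.2 fun _ => h⟩

theorem eq_vertex (s : Fin 1 ↪o Λ) : s = vertex Λ (s 0) := by
  ext i
  rw [Subsingleton.elim i 0]; rfl

theorem interU_vertex (l : Λ) : interU U (vertex Λ l) = U l :=
  Opens.ext (Set.ext fun _ => mem_interU_vertex)

theorem agree_of_cechδ_eq_zero {c : Cochain E U 0 k} (hc : cechδ U 0 k c = 0) (l m : Λ) {x : B}
    (hl : x ∈ U l) (hm : x ∈ U m) : (c (vertex Λ l)).1 x = (c (vertex Λ m)).1 x := by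
  -- Cochains see only increasing pairs; the remaining cases follow by symmetry.
  have key : ∀ l m, l < m → x ∈ U l → x ∈ U m →
      (c (vertex Λ l)).1 x = (c (vertex Λ m)).1 x := by
    intro l m hlm hl hm
    let s : Fin 2 ↪o Λ := OrderEmbedding.ofStrictMono ![l, m] (by
      intro i j hij
      fin_cases i <;> fin_cases j <;> simp_all)
    have hs : x ∈ interU U s := mem_interU.2 fun i => by fin_cases i <;> assumption
    have h0 : face s 0 = vertex Λ m := eq_vertex _
    have h1 : face s 1 = vertex Λ l := eq_vertex _
    have h := cechδ_zero_apply c s hs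
    rw [hc, h0, h1] at h
    exact (sub_eq_zero.1 h.symm).symm
  rcases lt_trichotomy l m with h | rfl | h
  · exact key l m h hl hm
  · rfl
  · exact (key m l h hm hl).symm

/-- A cocycle of the Čech complex of bidegree `(0, k)` is given by a form. -/
theorem exists_ofFamily_restrictFamily_eq (hU : ∀ b, ∃ l, b ∈ U l) {c : Cochain E U 0 k}
    (hc : cechδ U 0 k c = 0) :
    ∃ η : Form E (⊤ : Opens B) k, ofFamily U k (restrictFamily U k η) = c := by
  obtain ⟨η, hη⟩ := exists_form_of_agree (O := fun s : Fin 1 ↪o Λ => interU U s)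
    (fun b => (hU b).imp' (vertex Λ) fun l hl => mem_interU_vertex.2 hl) c (by
      intro s t x hs ht
      rw [eq_vertex s] at hs ⊢
      rw [eq_vertex t] at ht ⊢
      exact agree_of_cechδ_eq_zero hc _ _ (mem_interU_vertex.1 hs) (mem_interU_vertex.1 ht))
  refine ⟨η, funext fun s => Form.ext fun x hx => ?_⟩
  rw [ofFamily_apply _ s hx, restrictFamily_apply η (interU_le U s 0 hx), hη s x hx]

variable [IsManifold 𝓘(ℝ, E) ∞ B]

/-- The exterior derivative of families of forms. -/
def extDFamily (U : Λ → Opens B) (k : ℕ) :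
    (∀ l, Form E (U l) k) →ₗ[ℂ] ∀ l, Form E (U l) (k + 1) :=
  LinearMap.pi fun l => extD (U l) k ∘ₗ LinearMap.proj l

theorem extDFamily_restrictFamily (η : Form E (⊤ : Opens B) k) :
    extDFamily U k (restrictFamily U k η) = restrictFamily U (k + 1) (extD ⊤ k η) :=
  funext fun _ => extD_restrictForm le_top k η

theorem cechD_ofFamily (β : ∀ l, Form E (U l) k) :
    cechD U 0 k (ofFamily U k β) = ofFamily U (k + 1) (extDFamily U k β) :=
  funext fun s => extD_restrictForm (interU_le U s 0) k (β (s 0))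

theorem restrictFamily_injective (hU : ∀ b, ∃ l, b ∈ U l) :
    Function.Injective (restrictFamily (E := E) U k) := fun η θ h => Form.ext fun x _ => by
  obtain ⟨l, hl⟩ := hU x
  rw [← restrictFamily_apply η hl, h, restrictFamily_apply θ hl]

theorem ofFamily_injective : Function.Injective (ofFamily (E := E) U k) := fun β β' h =>
  funext fun l => Form.ext fun x hx => by
    have hx' : x ∈ interU U (vertex Λ l) := mem_interU_vertex.2 hx
    have h1 := ofFamily_apply β _ hx'
    rw [h, ofFamily_apply β' _ hx'] at h1
    exact h1.symm

/-- The Poincaré lemma for the members of a good covering. -/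
theorem IsGoodCover.exists_extDFamily_eq (hU : IsGoodCover E U) (β : ∀ l, Form E (U l) (k + 1))
    (hβ : extDFamily U (k + 1) β = 0) : ∃ β' : ∀ l, Form E (U l) k, extDFamily U k β' = β := by
  have : ∀ l, ∃ b : Form E (U l) k, extD (U l) k b = β l := by
    intro l
    -- A good covering may have empty members. These are not contractible, but carry only the zero
    -- form.
    by_cases hl : (U l : Set B).Nonempty
    · have h := hU.2 0 (vertex Λ l)
      rw [interU_vertex] at h
      exact (h hl).exists_extD_eq (β l) (congrFun hβ l)
    · exact ⟨0, Form.ext fun x hx => absurd ⟨x, hx⟩ hl⟩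
  choose b hb using this
  exact ⟨b, funext hb⟩

end Gluing

/-! ### Local sections and injectivity of the pull-back -/

section Bundle
variable {E B E' N EF F : Type*} [NormedAddCommGroup E] [NormedSpace ℝ E]
  [TopologicalSpace B] [ChartedSpace E B] [IsManifold 𝓘(ℝ, E) ∞ B]
  [NormedAddCommGroup E'] [NormedSpace ℝ E']
  [TopologicalSpace N] [ChartedSpace E' N] [IsManifold 𝓘(ℝ, E') ∞ N]
  [NormedAddCommGroup EF] [NormedSpace ℝ EF]
  [TopologicalSpace F] [ChartedSpace EF F] [IsManifold 𝓘(ℝ, EF) ∞ F]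
  {π : C^∞⟮𝓘(ℝ, E'), N; 𝓘(ℝ, E), B⟯}

/-- A fibre bundle with non-empty total space has local sections. -/
theorem IsSmoothFibreBundle.exists_section [Nonempty N] (hπ : IsSmoothFibreBundle (EF := EF) F π)
    (b : B) : ∃ s : B → N, ContMDiffAt 𝓘(ℝ, E) 𝓘(ℝ, E') ∞ s b ∧ ∀ᶠ x in 𝓝 b, π (s x) = x := by
  obtain ⟨a⟩ := ‹Nonempty N›
  obtain ⟨e₀, -⟩ := hπ (π a)
  -- A point of the total space is used only to produce a point of the model fibre; the section over
  -- any other chart of the bundle is constant with this value.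
  let f₀ : F := (e₀ a).2
  obtain ⟨e, hb, -, he⟩ := hπ b
  have ht : (b, f₀) ∈ e.target := e.mem_target.2 hb
  refine ⟨fun x => e.toOpenPartialHomeomorph.symm (x, f₀), ?_, ?_⟩
  · exact (he.contMDiffAt (e.open_target.mem_nhds ht)).comp b
      (contMDiffAt_id.prodMk contMDiffAt_const)
  · filter_upwards [e.open_baseSet.mem_nhds hb] with x hx
    exact e.proj_symm_apply' hx

/-- For a local section `s` at `b` the composite `s^*π^*` is the identity at `b`, so `α b` is
recovered from `π^*α` at `s b`. -/
theorem IsSmoothFibreBundle.eq_of_rawPullback_eq [Nonempty N]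
    (hπ : IsSmoothFibreBundle (EF := EF) F π) {k : ℕ} {α β : RawForm E B k} {b : B}
    (h : ∀ a, π a = b → rawPullback π α a = (rawPullback π β : RawForm E' N k) a) : α b = β b := by
  obtain ⟨s, hs, hsec⟩ := hπ.exists_section b
  have hb : π (s b) = b := hsec.self_of_nhds
  have h1 := mfderiv_comp b (π.contMDiff.contMDiffAt.mdifferentiableAt (by simp))
    (hs.mdifferentiableAt (by simp))
  have h2 : π ∘ s =ᶠ[𝓝 b] id := hsec
  have h3 := h2.mfderiv_eq (I := 𝓘(ℝ, E)) (I' := 𝓘(ℝ, E))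
  have key : ∀ (γ : RawForm E B k) (v : Fin k → E), (γ b : E [⋀^Fin k]→L[ℝ] ℂ) v =
      (rawPullback π γ (s b) : E' [⋀^Fin k]→L[ℝ] ℂ)
        (fun i => mfderiv 𝓘(ℝ, E) 𝓘(ℝ, E') s b (v i)) := by
    intro γ v
    have hγ : ∀ p q : B, p = q → ∀ w : Fin k → E, (γ p : E [⋀^Fin k]→L[ℝ] ℂ) w
      = (γ q : E [⋀^Fin k]→L[ℝ] ℂ) w := by rintro p q rfl w; rfl
    refine (hγ _ _ hb.symm v).trans ?_
    refine congrArg (γ (π (s b)) : E [⋀^Fin k]→L[ℝ] ℂ) (funext fun i => ?_)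
    have h4 := DFunLike.congr_fun h1 (v i)
    have h5 := DFunLike.congr_fun h3 (v i)
    have h6 : (mfderiv 𝓘(ℝ, E) 𝓘(ℝ, E) (id : B → B) b) (v i) = v i := by
      rw [mfderiv_id]; rfl
    exact h6.symm.trans (h5.symm.trans h4)
  ext v
  rw [key α v, key β v, h _ hb]

end Bundle

/-! ### Isomorphisms induced by linear maps with equal kernels -/

section CohomologyMaps
variable {C : ℕ → Type*} [∀ n, AddCommGroup (C n)] [∀ n, Module ℂ (C n)]
  {P H H' : Type*} [AddCommGroup P] [Module ℂ P] [AddCommGroup H] [Module ℂ H]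
  [AddCommGroup H'] [Module ℂ H']

/-- The classes of a linear family of cocycles. -/
def clsLin (d : ∀ n, C n →ₗ[ℂ] C (n + 1)) (n : ℕ) (g : P →ₗ[ℂ] C n) (hg : ∀ p, d n (g p) = 0) :
    P →ₗ[ℂ] Cohomology d n :=
  Submodule.mkQ _ ∘ₗ g.codRestrict (LinearMap.ker (d n)) hg

theorem clsLin_eq_zero_iff {d : ∀ n, C n →ₗ[ℂ] C (n + 1)} {n : ℕ} {g : P →ₗ[ℂ] C n}
    {hg : ∀ p, d n (g p) = 0} {p : P} : clsLin d n g hg p = 0 ↔ g p ∈ coboundaries d n :=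
  Submodule.Quotient.mk_eq_zero _

/-- Two linear maps with the same kernel have isomorphic images. -/
theorem exists_equiv_of_ker_eq {f : P →ₗ[ℂ] H} {g : P →ₗ[ℂ] H'} (hf : Function.Surjective f)
    (hker : ∀ p, f p = 0 ↔ g p = 0) {S : Submodule ℂ H'} (hS : LinearMap.range g = S) :
    ∃ Φ : H ≃ₗ[ℂ] S, ∀ p, (Φ (f p) : H') = g p := by
  have hk : LinearMap.ker f = LinearMap.ker g := Submodule.ext hker
  refine ⟨(f.quotKerEquivOfSurjective hf).symm ≪≫ₗ Submodule.quotEquivOfEq _ _ hk ≪≫ₗ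
    g.quotKerEquivRange ≪≫ₗ LinearEquiv.ofEq _ _ hS, fun p => ?_⟩
  have h : (f.quotKerEquivOfSurjective hf).symm (f p) = Submodule.Quotient.mk p := by
    rw [LinearEquiv.symm_apply_eq]; rfl
  simp only [LinearEquiv.trans_apply, h]
  rfl

theorem exists_cls_eq {d : ∀ n, C n →ₗ[ℂ] C (n + 1)} {n : ℕ} (x : Cohomology d n) :
    ∃ z h, cls d n z h = x := by
  obtain ⟨⟨z, hz⟩, rfl⟩ := Submodule.Quotient.mk_surjective _ x
  exact ⟨z, hz, rfl⟩

/-- A linear map on the preimages of the cocycles that vanishes precisely on the preimages of the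
coboundaries induces an isomorphism of the cohomology with its image. -/
theorem exists_cohomology_equiv {d : ∀ n, C n →ₗ[ℂ] C (n + 1)} {n : ℕ} {T : Type*} [AddCommGroup T]
    [Module ℂ T] {t : T →ₗ[ℂ] C n} (ht : Function.Surjective t) {P : Submodule ℂ T}
    (hP : ∀ x, x ∈ P ↔ d n (t x) = 0) (g : P →ₗ[ℂ] H')
    (hker : ∀ p : P, t p ∈ coboundaries d n ↔ g p = 0) {S : Submodule ℂ H'}
    (hS : LinearMap.range g = S) :
    ∃ Φ : Cohomology d n ≃ₗ[ℂ] S, ∀ (x : T) (h : d n (t x) = 0),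
      (Φ (cls d n (t x) h) : H') = g ⟨x, (hP x).2 h⟩ := by
  have hf : Function.Surjective
      (clsLin d n (t ∘ₗ P.subtype) fun p => (hP p).1 p.2) := by
    intro y
    obtain ⟨z, hz, rfl⟩ := exists_cls_eq y
    obtain ⟨x, rfl⟩ := ht z
    exact ⟨⟨x, (hP x).2 hz⟩, rfl⟩
  obtain ⟨Φ, hΦ⟩ := exists_equiv_of_ker_eq hf
    (fun p => clsLin_eq_zero_iff.trans (hker p)) hS
  exact ⟨Φ, fun x h => hΦ ⟨x, (hP x).2 h⟩⟩

end CohomologyMaps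

/-! ### Cocycles and coboundaries of the complexes of the bundle -/

section Relative
variable {E B E' N EF F Λ : Type*} [NormedAddCommGroup E] [NormedSpace ℝ E]
  [TopologicalSpace B] [ChartedSpace E B] [IsManifold 𝓘(ℝ, E) ∞ B]
  [NormedAddCommGroup E'] [NormedSpace ℝ E']
  [TopologicalSpace N] [ChartedSpace E' N] [IsManifold 𝓘(ℝ, E') ∞ N]
  [NormedAddCommGroup EF] [NormedSpace ℝ EF]
  [TopologicalSpace F] [ChartedSpace EF F] [IsManifold 𝓘(ℝ, EF) ∞ F]
  [LinearOrder Λ] {U : Λ → Opens B} {k : ℕ}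

/-- The pull-back of forms on the whole manifold. -/
def pullbackTop (π : C^∞⟮𝓘(ℝ, E'), N; 𝓘(ℝ, E), B⟯) (k : ℕ) :
    Form E (⊤ : Opens B) k →ₗ[ℂ] Form E' (⊤ : Opens N) k :=
  pullbackForm π (U := ⊤) (W := ⊤) (mapsTo_univ _ _) k

variable {π : C^∞⟮𝓘(ℝ, E'), N; 𝓘(ℝ, E), B⟯}

theorem pullbackForm_apply {V : Opens B} {W : Opens N} (h : MapsTo π W V) (α : Form E V k) {x : N}
    (hx : x ∈ W) : (pullbackForm π h k α).1 x = rawPullback π α.1 x := cut_of_mem _ hx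

theorem extD_pullbackTop (η : Form E (⊤ : Opens B) k) :
    extD ⊤ k (pullbackTop π k η) = pullbackTop π (k + 1) (extD ⊤ k η) :=
  extD_pullbackForm π _ k η

theorem rawPullback_congr {α β : RawForm E B k} {x : N} (h : α (π x) = β (π x)) :
    (rawPullback π α : RawForm E' N k) x = rawPullback π β x := by
  ext v
  exact DFunLike.congr_fun h _

theorem tildeMap_apply (α : Form E' (⊤ : Opens N) k) (β : ∀ l, Form E (U l) k) (l : Λ) {x : N}
    (hx : π x ∈ U l) :
    (tildeMap π U k (α, β) l).1 x = α.1 x - rawPullback π (β l).1 x :=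
  congrArg₂ (· - ·) (restrictForm_apply (le_top : preim π (U l) ≤ ⊤) α hx)
    (pullbackForm_apply (W := preim π (U l)) (mapsTo_preimage _ _) (β l) hx)

theorem tildeMap_eq_zero_iff_forall {α : Form E' (⊤ : Opens N) k} {β : ∀ l, Form E (U l) k} :
    tildeMap π U k (α, β) = 0 ↔
      ∀ l x, π x ∈ U l → α.1 x = rawPullback π (β l).1 x := by
  constructor
  · intro h l x hx
    have h1 := tildeMap_apply α β l hx
    rw [h] at h1
    exact sub_eq_zero.1 h1.symm
  · intro h
    refine funext fun l => Form.ext fun x hx => ?_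
    rw [tildeMap_apply α β l hx, h l x hx, sub_self]
    rfl

theorem tildeMap_pullbackTop_restrictFamily (η : Form E (⊤ : Opens B) k) :
    tildeMap π U k (pullbackTop π k η, restrictFamily U k η) = 0 :=
  tildeMap_eq_zero_iff_forall.2 fun _ _ hx =>
    (pullbackForm_apply (W := ⊤) (mapsTo_univ _ _) η trivial).trans
      (rawPullback_congr (restrictFamily_apply η hx).symm)

theorem familyD_tildeMap (α : Form E' (⊤ : Opens N) k) (β : ∀ l, Form E (U l) k) :
    familyD π U k (tildeMap π U k (α, β)) =
      tildeMap π U (k + 1) (extD ⊤ k α, extDFamily U k β) := by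
  funext l
  have h1 := extD_restrictForm (le_top : preim π (U l) ≤ ⊤) k α
  have h2 := extD_pullbackForm π (W := preim π (U l)) (mapsTo_preimage _ _) k (β l)
  simp only [tildeMap, familyD, LinearMap.pi_apply, LinearMap.sub_apply, LinearMap.comp_apply,
    LinearMap.fst_apply, LinearMap.snd_apply, LinearMap.proj_apply, map_sub]
  exact congrArg₂ (· - ·) h1 h2

theorem tildeD_tilde_eq_zero_iff {α : Form E' (⊤ : Opens N) k} {β : ∀ l, Form E (U l) k} :
    tildeD π U k (tilde π U α β) = 0 ↔
      tildeMap π U (k + 1) (extD ⊤ k α, extDFamily U k β) = 0 := by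
  rw [← familyD_tildeMap]
  exact Subtype.ext_iff

theorem tildeD_tilde_eq_zero {α : Form E' (⊤ : Opens N) k} {β : ∀ l, Form E (U l) k}
    {γ : Form E (⊤ : Opens B) (k + 1)} (h1 : extDFamily U k β = restrictFamily U (k + 1) γ) (h2 : extD ⊤ k α = pullbackTop π (k + 1) γ) :
    tildeD π U k (tilde π U α β) = 0 := by
  rw [tildeD_tilde_eq_zero_iff, h1, h2, tildeMap_pullbackTop_restrictFamily]

variable [Nonempty N] (hπ : IsSmoothFibreBundle (EF := EF) F π)

include hπ in
theorem pullbackTop_injective : Function.Injective (pullbackTop π k) := fun η θ h =>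
  Form.ext fun b _ => hπ.eq_of_rawPullback_eq fun a _ => by
    have h1 := pullbackForm_apply (W := ⊤) (mapsTo_univ π _) η (x := a) trivial
    have h2 := pullbackForm_apply (W := ⊤) (mapsTo_univ π _) θ (x := a) trivial
    exact h1.symm.trans ((congrFun (congrArg Subtype.val h) a).trans h2)

include hπ in
/-- The kernel of `(ω̂, ω) ↦ ω̃` consists of the forms on the base. -/
theorem exists_of_tildeMap_eq_zero (hU : ∀ b, ∃ l, b ∈ U l) {α : Form E' (⊤ : Opens N) k}
    {β : ∀ l, Form E (U l) k} (h : tildeMap π U k (α, β) = 0) :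
    ∃ η : Form E (⊤ : Opens B) k, restrictFamily U k η = β ∧ pullbackTop π k η = α := by
  rw [tildeMap_eq_zero_iff_forall] at h
  -- Over `U_l ∩ U_m` both `π^*ω_l` and `π^*ω_m` equal `ω̂`, and `π^*` is injective at each point;
  -- hence the `ω_l` glue.
  obtain ⟨η, hη⟩ := exists_form_of_agree hU β fun l m b hl hm =>
    hπ.eq_of_rawPullback_eq fun a ha => by
      subst ha
      rw [← h l a hl, h m a hm]
  refine ⟨η, funext fun l => Form.ext fun x hx => ?_, Form.ext fun a _ => ?_⟩
  · rw [restrictFamily_apply η hx, hη l x hx]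
  · obtain ⟨l, hl⟩ := hU (π a)
    rw [h l a hl]
    exact (pullbackForm_apply (W := ⊤) (mapsTo_univ _ _) η trivial).trans
      (rawPullback_congr (hη l _ hl))

variable {α : Form E' (⊤ : Opens N) k} {β : ∀ l, Form E (U l) k}

-- `dω̃` is the family of the pair `(dω̂, dω)`, so its vanishing yields a form `γ` on the base. It
-- represents the connecting class of `ω̃`, and is closed because `π^*γ = dω̂` is closed and `π^*`
-- is injective.
include hπ in
theorem exists_of_tildeD_eq_zero (hU : ∀ b, ∃ l, b ∈ U l)
    (h : tildeD π U k (tilde π U α β) = 0) :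
    ∃ γ : Form E (⊤ : Opens B) (k + 1), extD ⊤ (k + 1) γ = 0 ∧
      restrictFamily U (k + 1) γ = extDFamily U k β ∧ pullbackTop π (k + 1) γ = extD ⊤ k α := by
  obtain ⟨γ, h1, h2⟩ := exists_of_tildeMap_eq_zero hπ hU (tildeD_tilde_eq_zero_iff.1 h)
  refine ⟨γ, pullbackTop_injective hπ ?_, h1, h2⟩
  rw [← extD_pullbackTop, h2, extD_extD, map_zero]

include hπ in
theorem totalD_single_cechD_eq_zero (hU : ∀ b, ∃ l, b ∈ U l)
    (h : tildeD π U k (tilde π U α β) = 0) :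
    totalD U (k + 1) (single U 0 (k + 1) (Nat.zero_add (k + 1))
      (cechD U 0 k (ofFamily U k β))) = 0 := by
  obtain ⟨γ, -, h1, -⟩ := exists_of_tildeD_eq_zero hπ hU h
  refine totalD_single_eq_zero _ ?_ (cechD_cechD _)
  rw [cechD_ofFamily, ← h1, cechδ_ofFamily_restrictFamily]

include hπ in
theorem totalD_single_cechδ_eq_zero (hU : ∀ b, ∃ l, b ∈ U l)
    (h : tildeD π U k (tilde π U α β) = 0) :
    totalD U (k + 1) (single U 1 k (Nat.add_comm 1 k) (cechδ U 0 k (ofFamily U k β))) = 0 := by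
  obtain ⟨γ, -, h1, -⟩ := exists_of_tildeD_eq_zero hπ hU h
  refine totalD_single_eq_zero _ (cechδ_cechδ _) ?_
  rw [cechD_cechδ, cechD_ofFamily, ← h1, cechδ_ofFamily_restrictFamily]

include hπ in
theorem relD_mk_eq_zero (hU : ∀ b, ∃ l, b ∈ U l) (h : tildeD π U k (tilde π U α β) = 0) :
    relD π k (Submodule.Quotient.mk α) = 0 := by
  obtain ⟨γ, -, -, h2⟩ := exists_of_tildeD_eq_zero hπ hU h
  exact (Submodule.Quotient.mk_eq_zero _).2 ⟨γ, h2⟩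

/-- The condition that the class of the closed form `dω_λ` on the base vanishes. -/
def IsTrivialFamily (β : ∀ l, Form E (U l) k) : Prop :=
  ∃ η : Form E (⊤ : Opens B) k, extDFamily U k (restrictFamily U k η) = extDFamily U k β

/-- Exact rows allow a primitive to be chosen in bidegree `(0, k)` and `δ`-closed, which means that
it is a global form `η`. -/
theorem single_cechD_mem_coboundaries_iff (hU : ∀ b, ∃ l, b ∈ U l)
    (ρ : SmoothPartitionOfUnity Λ 𝓘(ℝ, E) B univ) (hρ : ρ.IsSubordinate fun l => (U l : Set B)) :
    single U 0 (k + 1) (Nat.zero_add (k + 1)) (cechD U 0 k (ofFamily U k β)) ∈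
      coboundaries (totalD (E := E) U) (k + 1) ↔ IsTrivialFamily β := by
  constructor
  · rintro ⟨c, hc⟩
    obtain ⟨b, hb, hbd⟩ := exists_cechD_eq_of_totalD_eq_single
      (fun p q c h => exists_cechδ_eq ρ hρ c h) c hc
    obtain ⟨η, rfl⟩ := exists_ofFamily_restrictFamily_eq hU hb
    rw [cechD_ofFamily, cechD_ofFamily] at hbd
    exact ⟨η, ofFamily_injective hbd⟩
  · rintro ⟨η, hη⟩
    refine ⟨single U 0 k (Nat.zero_add k) (ofFamily U k (restrictFamily U k η)), ?_⟩
    rw [totalD_single, cechδ_ofFamily_restrictFamily, map_zero, zero_add, pow_zero, one_smul,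
      cechD_ofFamily, cechD_ofFamily, hη]

/-- The sum is the total coboundary of `b` itself, the sign of `d` being `(-1)⁰`. This makes the
classes of `δω` and `dω` opposite. -/
theorem single_cechδ_add_single_cechD_mem_coboundaries (b : Cochain E U 0 k) :
    single U 1 k (Nat.add_comm 1 k) (cechδ U 0 k b) +
      single U 0 (k + 1) (Nat.zero_add (k + 1)) (cechD U 0 k b) ∈
      coboundaries (totalD (E := E) U) (k + 1) := by
  refine ⟨single U 0 k (Nat.zero_add k) b, ?_⟩
  rw [totalD_single, pow_zero, one_smul]

variable {α : Form E' (⊤ : Opens N) (k + 1)} {β : ∀ l, Form E (U l) (k + 1)}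

-- If `ω̃ = dξ̃`, then the difference of the two pairs comes from a form `η` on the base, and `dη =
-- dω_λ`. Conversely, such an `η` makes `ω̂ - π^*η` and `ω_λ - η` closed, hence exact by the
-- Poincaré lemma in positive degree, and the pair of `η` that was subtracted does not affect `ω̃`.
include hπ in
theorem tilde_mem_coboundaries_iff (hU : IsGoodCover E U)
    (hN : SmoothlyContractible E' (⊤ : Opens N))
    (h : tildeD π U (k + 1) (tilde π U α β) = 0) :
    tilde π U α β ∈ coboundaries (C := fun n => TildeForm π U n) (tildeD π U) (k + 1) ↔
      IsTrivialFamily β := by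
  constructor
  · rintro ⟨⟨_, ⟨⟨ξ, ζ⟩, rfl⟩⟩, h1⟩
    have h2 : familyD π U k (tildeMap π U k (ξ, ζ)) = tildeMap π U (k + 1) (α, β) :=
      congrArg Subtype.val h1
    rw [familyD_tildeMap] at h2
    have h3 : tildeMap π U (k + 1) (α - extD ⊤ k ξ, β - extDFamily U k ζ) = 0 := by
      rw [← Prod.mk_sub_mk, map_sub, h2, sub_self]
    obtain ⟨η, h4, -⟩ := exists_of_tildeMap_eq_zero hπ hU.1 h3
    refine ⟨η, ?_⟩
    rw [h4, map_sub, sub_eq_self]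
    exact funext fun l => extD_extD (ζ l)
  · rintro ⟨η, hη⟩
    obtain ⟨γ, -, h1, h2⟩ := exists_of_tildeD_eq_zero hπ hU.1 h
    have hγ : extD ⊤ (k + 1) η = γ := by
      refine restrictFamily_injective hU.1 ?_
      rw [h1, ← hη, extDFamily_restrictFamily]
    obtain ⟨ζ, hζ⟩ := hU.exists_extDFamily_eq (β - restrictFamily U (k + 1) η) (by
      rw [map_sub, hη, sub_self])
    obtain ⟨ξ, hξ⟩ := hN.exists_extD_eq (α - pullbackTop π (k + 1) η) (by
      rw [map_sub, extD_pullbackTop, hγ, h2, sub_self])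
    refine ⟨tilde π U ξ ζ, Subtype.ext ?_⟩
    change familyD π U k (tildeMap π U k (ξ, ζ)) = tildeMap π U (k + 1) (α, β)
    rw [familyD_tildeMap, hξ, hζ, ← Prod.mk_sub_mk, map_sub, tildeMap_pullbackTop_restrictFamily,
      sub_zero]

include hπ in
theorem mk_mem_coboundaries_iff (hU : ∀ b, ∃ l, b ∈ U l)
    (hN : SmoothlyContractible E' (⊤ : Opens N))
    (h : tildeD π U (k + 1) (tilde π U α β) = 0) :
    (Submodule.Quotient.mk α : RelForm π (k + 1)) ∈ coboundaries (relD π) (k + 1) ↔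
      IsTrivialFamily β := by
  obtain ⟨γ, -, h1, h2⟩ := exists_of_tildeD_eq_zero hπ hU h
  constructor
  · rintro ⟨x, hx⟩
    obtain ⟨ξ, rfl⟩ := Submodule.Quotient.mk_surjective _ x
    obtain ⟨η, hη⟩ := (Submodule.Quotient.eq _).1 hx
    change pullbackTop π (k + 1) η = extD ⊤ k ξ - α at hη
    -- Since `π^*η = dξ - ω̂`, the form `-η` satisfies `π^*d(-η) = dω̂ = π^*γ`.
    refine ⟨-η, ?_⟩
    rw [extDFamily_restrictFamily, ← h1]
    congr 1
    refine pullbackTop_injective hπ ?_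
    rw [h2, ← extD_pullbackTop, map_neg, hη, neg_sub, map_sub, extD_extD, sub_zero]
  · rintro ⟨η, hη⟩
    have hγ : extD ⊤ (k + 1) η = γ := by
      refine restrictFamily_injective hU ?_
      rw [h1, ← hη, extDFamily_restrictFamily]
    obtain ⟨ξ, hξ⟩ := hN.exists_extD_eq (α - pullbackTop π (k + 1) η) (by
      rw [map_sub, extD_pullbackTop, hγ, h2, sub_self])
    refine ⟨Submodule.Quotient.mk ξ, (Submodule.Quotient.eq _).2 ⟨-η, ?_⟩⟩
    change pullbackTop π (k + 1) (-η) = extD ⊤ k ξ - α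
    rw [hξ, map_neg, sub_sub_cancel_left]

end Relative

/-! ### The three maps on pairs, their kernels and ranges -/

section Parts
set_option maxSynthPendingDepth 3
variable {E B E' N EF F Λ : Type*} [NormedAddCommGroup E] [NormedSpace ℝ E]
  [TopologicalSpace B] [ChartedSpace E B] [IsManifold 𝓘(ℝ, E) ∞ B]
  [NormedAddCommGroup E'] [NormedSpace ℝ E']
  [TopologicalSpace N] [ChartedSpace E' N] [IsManifold 𝓘(ℝ, E') ∞ N]
  [LinearOrder Λ] {U : Λ → Opens B} {k : ℕ} {π : C^∞⟮𝓘(ℝ, E'), N; 𝓘(ℝ, E), B⟯}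

theorem mem_cechDRPart_iff {n p q : ℕ} {h : p + q = n} {x : CechDR E U n} :
    x ∈ CechDRPart E U p q h ↔
      ∃ c hc, cls (totalD U) n (single U p q h c) hc = x := by
  constructor
  · rintro ⟨⟨z, hz⟩, ⟨c, rfl⟩, rfl⟩
    exact ⟨c, hz, rfl⟩
  · rintro ⟨c, hc, rfl⟩
    exact ⟨⟨_, hc⟩, ⟨c, rfl⟩, rfl⟩

/-- The source of surjectivity: primitives of `γ` on the `U_λ` and of `π^*γ` on the contractible
total space form a pair whose family `ω̃` is closed. -/
theorem exists_tilde_of_closed (hU : IsGoodCover E U) (hN : SmoothlyContractible E' (⊤ : Opens N))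
    {γ : Form E (⊤ : Opens B) (k + 1)} (hγ : extD ⊤ (k + 1) γ = 0) :
    ∃ (α : Form E' (⊤ : Opens N) k) (β : ∀ l, Form E (U l) k),
      tildeD π U k (tilde π U α β) = 0 ∧ extDFamily U k β = restrictFamily U (k + 1) γ := by
  obtain ⟨β, hβ⟩ := hU.exists_extDFamily_eq (restrictFamily U (k + 1) γ) (by
    rw [extDFamily_restrictFamily, hγ, map_zero])
  obtain ⟨α, hα⟩ := hN.exists_extD_eq (pullbackTop π (k + 1) γ) (by
    rw [extD_pullbackTop, hγ, map_zero])
  exact ⟨α, β, tildeD_tilde_eq_zero hβ hα, hβ⟩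

theorem exists_closed_of_totalD_single (hU : ∀ b, ∃ l, b ∈ U l) {c : Cochain E U 0 k} {n : ℕ}
    (h : 0 + k = n) (hc : totalD U n (single U 0 k h c) = 0) :
    ∃ γ : Form E (⊤ : Opens B) k, extD ⊤ k γ = 0 ∧ ofFamily U k (restrictFamily U k γ) = c := by
  obtain ⟨γ, rfl⟩ := exists_ofFamily_restrictFamily_eq hU (cechδ_eq_zero_of_totalD_single h hc)
  refine ⟨γ, ?_, rfl⟩
  have h1 := cechD_eq_zero_of_totalD_single h hc
  rw [cechD_ofFamily, extDFamily_restrictFamily] at h1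
  refine restrictFamily_injective hU (ofFamily_injective ?_)
  rw [h1, map_zero, map_zero]

theorem cls_single_cechδ_eq_neg (b : Cochain E U 0 k)
    (h1 : totalD U (k + 1) (single U 1 k (Nat.add_comm 1 k) (cechδ U 0 k b)) = 0)
    (h0 : totalD U (k + 1) (single U 0 (k + 1) (Nat.zero_add (k + 1)) (cechD U 0 k b)) = 0) :
    cls (totalD U) (k + 1) _ h1 = -cls (totalD U) (k + 1) _ h0 := by
  rw [eq_neg_iff_add_eq_zero]
  exact (Submodule.Quotient.mk_eq_zero _).2 (single_cechδ_add_single_cechD_mem_coboundaries b)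

/-- In the presence of a partition of unity the two parts of the Čech-de Rham cohomology agree. -/
theorem cechDRPart_one_le (ρ : SmoothPartitionOfUnity Λ 𝓘(ℝ, E) B univ)
    (hρ : ρ.IsSubordinate fun l => (U l : Set B)) :
    CechDRPart E U 1 k (Nat.add_comm 1 k) ≤
      CechDRPart E U 0 (k + 1) (Nat.zero_add (k + 1)) := by
  intro x hx
  obtain ⟨c, hc, rfl⟩ := mem_cechDRPart_iff.1 hx
  -- Writing the cocycle as `δb`, the cochain `db` is `δ`-closed because `δdb = dδb = 0`, and the
  -- class of `δb` is minus that of `db`.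
  obtain ⟨b, rfl⟩ := exists_cechδ_eq ρ hρ c (cechδ_eq_zero_of_totalD_single _ hc)
  have h0 : totalD U (k + 1) (single U 0 (k + 1) (Nat.zero_add (k + 1)) (cechD U 0 k b)) = 0 := by
    refine totalD_single_eq_zero _ ?_ (cechD_cechD b)
    rw [← cechD_cechδ, cechD_eq_zero_of_totalD_single _ hc]
  rw [cls_single_cechδ_eq_neg b hc h0]
  exact Submodule.neg_mem _ (mem_cechDRPart_iff.2 ⟨_, h0, rfl⟩)

/-- The pairs `(ω̂, ω)` for which `ω̃` is a cocycle. -/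
def tildeCocycles (π : C^∞⟮𝓘(ℝ, E'), N; 𝓘(ℝ, E), B⟯) (U : Λ → Opens B) (k : ℕ) : Submodule ℂ (Form E' (⊤ : Opens N) k × ∀ l, Form E (U l) k) :=
  LinearMap.ker (tildeMap π U (k + 1) ∘ₗ (extD ⊤ k).prodMap (extDFamily U k))

theorem mem_tildeCocycles_iff {x : Form E' (⊤ : Opens N) k × ∀ l, Form E (U l) k} :
    x ∈ tildeCocycles π U k ↔ tildeD π U k (tilde π U x.1 x.2) = 0 :=
  tildeD_tilde_eq_zero_iff.symm

variable [Nonempty N] [NormedAddCommGroup EF] [NormedSpace ℝ EF]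
  [TopologicalSpace F] [ChartedSpace EF F] [IsManifold 𝓘(ℝ, EF) ∞ F]
  (hπ : IsSmoothFibreBundle (EF := EF) F π)

/-- The map `(ω̂, ω) ↦ [dω]`. -/
def classCechD (hU : ∀ b, ∃ l, b ∈ U l) : tildeCocycles π U k →ₗ[ℂ] CechDR E U (k + 1) :=
  clsLin (totalD U) (k + 1) (single U 0 (k + 1) (Nat.zero_add (k + 1)) ∘ₗ cechD U 0 k ∘ₗ
    ofFamily U k ∘ₗ LinearMap.snd ℂ _ _ ∘ₗ (tildeCocycles π U k).subtype)
    fun p => totalD_single_cechD_eq_zero hπ hU (mem_tildeCocycles_iff.1 p.2)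

/-- The map `(ω̂, ω) ↦ [δω]`. -/
def classCechδ (hU : ∀ b, ∃ l, b ∈ U l) : tildeCocycles π U k →ₗ[ℂ] CechDR E U (k + 1) :=
  clsLin (totalD U) (k + 1) (single U 1 k (Nat.add_comm 1 k) ∘ₗ cechδ U 0 k ∘ₗ
    ofFamily U k ∘ₗ LinearMap.snd ℂ _ _ ∘ₗ (tildeCocycles π U k).subtype)
    fun p => totalD_single_cechδ_eq_zero hπ hU (mem_tildeCocycles_iff.1 p.2)

/-- The map `(ω̂, ω) ↦ [ω̂]`. -/
def classRel (hU : ∀ b, ∃ l, b ∈ U l) : tildeCocycles π U k →ₗ[ℂ] RelCohomology π k :=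
  clsLin (relD π) k (Submodule.mkQ _ ∘ₗ LinearMap.fst ℂ _ _ ∘ₗ (tildeCocycles π U k).subtype)
    fun p => relD_mk_eq_zero hπ hU (mem_tildeCocycles_iff.1 p.2)

theorem classCechδ_eq_neg (hU : ∀ b, ∃ l, b ∈ U l) (p : tildeCocycles π U k) :
    classCechδ hπ hU p = -classCechD hπ hU p :=
  cls_single_cechδ_eq_neg (ofFamily U k p.1.2) _ _

theorem classCechD_eq_zero_iff (hU : ∀ b, ∃ l, b ∈ U l)
    (ρ : SmoothPartitionOfUnity Λ 𝓘(ℝ, E) B univ) (hρ : ρ.IsSubordinate fun l => (U l : Set B))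
    (p : tildeCocycles π U k) : classCechD hπ hU p = 0 ↔ IsTrivialFamily p.1.2 :=
  clsLin_eq_zero_iff.trans (single_cechD_mem_coboundaries_iff hU ρ hρ)

theorem classRel_eq_zero_iff (hU : ∀ b, ∃ l, b ∈ U l) (hN : SmoothlyContractible E' (⊤ : Opens N))
    (p : tildeCocycles π U (k + 1)) : classRel hπ hU p = 0 ↔ IsTrivialFamily p.1.2 :=
  clsLin_eq_zero_iff.trans (mk_mem_coboundaries_iff hπ hU hN (mem_tildeCocycles_iff.1 p.2))

theorem range_classCechD (hU : IsGoodCover E U) (hN : SmoothlyContractible E' (⊤ : Opens N)) :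
    LinearMap.range (classCechD (k := k) hπ hU.1) =
      CechDRPart E U 0 (k + 1) (Nat.zero_add (k + 1)) := by
  refine le_antisymm ?_ fun x hx => ?_
  · rintro _ ⟨p, rfl⟩
    exact mem_cechDRPart_iff.2 ⟨_, _, rfl⟩
  · obtain ⟨c, hc, rfl⟩ := mem_cechDRPart_iff.1 hx
    obtain ⟨γ, hγ, rfl⟩ := exists_closed_of_totalD_single hU.1 _ hc
    obtain ⟨α, β, h, hβ⟩ := exists_tilde_of_closed (π := π) hU hN hγ
    refine ⟨⟨(α, β), mem_tildeCocycles_iff.2 h⟩, ?_⟩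
    have h1 : cechD U 0 k (ofFamily U k β) =
        ofFamily U (k + 1) (restrictFamily U (k + 1) γ) := by rw [cechD_ofFamily, hβ]
    simp only [← h1]
    rfl

theorem range_classCechδ (hU : IsGoodCover E U) (hN : SmoothlyContractible E' (⊤ : Opens N))
    (ρ : SmoothPartitionOfUnity Λ 𝓘(ℝ, E) B univ) (hρ : ρ.IsSubordinate fun l => (U l : Set B)) :
    LinearMap.range (classCechδ (k := k) hπ hU.1) =
      CechDRPart E U 1 k (Nat.add_comm 1 k) := by
  refine le_antisymm ?_ fun x hx => ?_
  · rintro _ ⟨p, rfl⟩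
    exact mem_cechDRPart_iff.2 ⟨_, _, rfl⟩
  -- A class of bidegree `(1, k)` is also one of bidegree `(0, k + 1)`, hence some `[dω]`; the sign
  -- in `[δω] = -[dω]` is absorbed by passing to `-p`.
  · have h1 := cechDRPart_one_le ρ hρ hx
    rw [← range_classCechD hπ hU hN] at h1
    obtain ⟨p, rfl⟩ := h1
    exact ⟨-p, by rw [classCechδ_eq_neg, map_neg, neg_neg]⟩

/-- Here `ω̂` is given, with `dω̂ = π^*γ`, and only the `ω_λ` have to be found: they are primitives
of the closed form `γ` on the members of the covering. -/
theorem range_classRel (hU : IsGoodCover E U) :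
    LinearMap.range (classRel (k := k) hπ hU.1) = ⊤ := by
  refine LinearMap.range_eq_top.2 fun x => ?_
  obtain ⟨y, hy, rfl⟩ := exists_cls_eq (d := relD π) x
  obtain ⟨α, rfl⟩ := Submodule.Quotient.mk_surjective _ y
  obtain ⟨γ, hγ⟩ := (Submodule.Quotient.mk_eq_zero _).1 hy
  change pullbackTop π (k + 1) γ = extD ⊤ k α at hγ
  have hγ0 : extD ⊤ (k + 1) γ = 0 := pullbackTop_injective hπ (by
    rw [← extD_pullbackTop, hγ, extD_extD, map_zero])
  obtain ⟨β, hβ⟩ := hU.exists_extDFamily_eq (restrictFamily U (k + 1) γ) (by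
    rw [extDFamily_restrictFamily, hγ0, map_zero])
  exact ⟨⟨(α, β), mem_tildeCocycles_iff.2 (tildeD_tilde_eq_zero hβ hγ.symm)⟩, rfl⟩

-- The common form of the three isomorphisms: only the map `g`, with kernel described by
-- `IsTrivialFamily`, and its range vary.
include hπ in
theorem exists_tildeCohomology_equiv (hU : IsGoodCover E U)
    (hN : SmoothlyContractible E' (⊤ : Opens N)) {H : Type*} [AddCommGroup H] [Module ℂ H]
    (g : tildeCocycles π U (k + 1) →ₗ[ℂ] H) (hg : ∀ p, g p = 0 ↔ IsTrivialFamily p.1.2)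
    {S : Submodule ℂ H} (hS : LinearMap.range g = S) :
    ∃ Φ : TildeCohomology π U (k + 1) ≃ₗ[ℂ] S,
      ∀ α β (h : tildeD π U (k + 1) (tilde π U α β) = 0),
        (Φ (cls (C := fun n => TildeForm π U n) (tildeD π U) (k + 1) (tilde π U α β) h) : H) =
          g ⟨(α, β), mem_tildeCocycles_iff.2 h⟩ := by
  obtain ⟨Φ, hΦ⟩ := exists_cohomology_equiv (C := fun n => TildeForm π U n) (d := tildeD π U)
    (tildeMap π U (k + 1)).surjective_rangeRestrict
    (fun _ => mem_tildeCocycles_iff) g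
    (fun p => (tilde_mem_coboundaries_iff hπ hU hN (mem_tildeCocycles_iff.1 p.2)).trans
      (hg p).symm) hS
  exact ⟨Φ, fun α β h => hΦ (α, β) h⟩

set_option maxHeartbeats 800000 in
include hπ in
theorem exists_cohomology_equivs (hU : IsGoodCover E U)
    (hN : SmoothlyContractible E' (⊤ : Opens N))
    (ρ : SmoothPartitionOfUnity Λ 𝓘(ℝ, E) B univ) (hρ : ρ.IsSubordinate fun l => (U l : Set B)) :
    ∃ (Φ₁ : TildeCohomology π U (k + 1) ≃ₗ[ℂ]
          CechDRPart E U 1 (k + 1) (Nat.add_comm 1 (k + 1)))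
      (Φ₀ : TildeCohomology π U (k + 1) ≃ₗ[ℂ]
          CechDRPart E U 0 (k + 1 + 1) (Nat.zero_add (k + 1 + 1)))
      (Φ : TildeCohomology π U (k + 1) ≃ₗ[ℂ] RelCohomology π (k + 1)),
      ∀ (α : Form E' (⊤ : Opens N) (k + 1)) (β : ∀ l, Form E (U l) (k + 1))
        (h : tildeD π U (k + 1) (tilde π U α β) = 0),
        (∃ h₁, (Φ₁ (cls (tildeD π U) (k + 1) (tilde π U α β) h) : CechDR E U (k + 1 + 1)) =
          cls (totalD U) (k + 1 + 1)
            (single U 1 (k + 1) (Nat.add_comm 1 (k + 1))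
              (cechδ U 0 (k + 1) (ofFamily U (k + 1) β))) h₁) ∧
        (∃ h₀, (Φ₀ (cls (tildeD π U) (k + 1) (tilde π U α β) h) : CechDR E U (k + 1 + 1)) =
          cls (totalD U) (k + 1 + 1)
            (single U 0 (k + 1 + 1) (Nat.zero_add (k + 1 + 1))
              (cechD U 0 (k + 1) (ofFamily U (k + 1) β))) h₀) ∧
        (∃ h₂, Φ (cls (tildeD π U) (k + 1) (tilde π U α β) h) =
          cls (relD π) (k + 1) (Submodule.Quotient.mk α) h₂) := by
  have hg₀ := classCechD_eq_zero_iff (k := k + 1) hπ hU.1 ρ hρ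
  obtain ⟨Φ₁, hΦ₁⟩ := exists_tildeCohomology_equiv hπ hU hN (classCechδ hπ hU.1)
    (fun p => by rw [classCechδ_eq_neg, neg_eq_zero, hg₀]) (range_classCechδ hπ hU hN ρ hρ)
  obtain ⟨Φ₀, hΦ₀⟩ := exists_tildeCohomology_equiv hπ hU hN (classCechD hπ hU.1) hg₀
    (range_classCechD hπ hU hN)
  obtain ⟨Φ, hΦ⟩ := exists_tildeCohomology_equiv hπ hU hN (classRel hπ hU.1)
    (classRel_eq_zero_iff hπ hU.1 hN) (range_classRel hπ hU)
  -- The third map is onto, so its range is the submodule `⊤`, which is identified with the whole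
  -- relative cohomology.
  exact ⟨Φ₁, Φ₀, Φ ≪≫ₗ Submodule.topEquiv, fun α β h =>
    ⟨⟨_, hΦ₁ α β h⟩, ⟨_, hΦ₀ α β h⟩, ⟨_, hΦ α β h⟩⟩⟩

end Parts

end CechDeRham
end

open CechDeRham
theorem lemma4
    {E A EF B F Λ : Type*}
    [NormedAddCommGroup E] [NormedSpace ℝ E]
    [TopologicalSpace B] [T2Space B] [ChartedSpace E B] [IsManifold 𝓘(ℝ, E) ∞ B]
    [NormedAddCommGroup A] [NormedSpace ℝ A]
    [NormedAddCommGroup EF] [NormedSpace ℝ EF]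
    [TopologicalSpace F] [T2Space F] [ChartedSpace EF F] [IsManifold 𝓘(ℝ, EF) ∞ F]
    [LinearOrder Λ]
    (U : Λ → Opens B) (hU : IsGoodCover E U)
    (hρ : ∃ ρ : SmoothPartitionOfUnity Λ 𝓘(ℝ, E) B univ, ρ.IsSubordinate fun l => (U l : Set B))
    (π : C^∞⟮𝓘(ℝ, A), A; 𝓘(ℝ, E), B⟯) (hπ : IsSmoothFibreBundle (EF := EF) F π)
    (k : ℕ) (hk : 1 ≤ k) :
    ∃ (Φ₁ : TildeCohomology π U k ≃ₗ[ℂ] CechDRPart E U 1 k (Nat.add_comm 1 k))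
      (Φ₀ : TildeCohomology π U k ≃ₗ[ℂ] CechDRPart E U 0 (k + 1) (Nat.zero_add (k + 1)))
      (Φ : TildeCohomology π U k ≃ₗ[ℂ] RelCohomology π k),
      ∀ (α : Form A (⊤ : Opens A) k) (β : ∀ l, Form E (U l) k)
        (h : tildeD π U k (tilde π U α β) = 0),
        (∃ h₁, (Φ₁ (cls (tildeD π U) k (tilde π U α β) h) : CechDR E U (k + 1)) =
          cls (totalD U) (k + 1)
            (single U 1 k (Nat.add_comm 1 k) (cechδ U 0 k (ofFamily U k β))) h₁) ∧
        (∃ h₀, (Φ₀ (cls (tildeD π U) k (tilde π U α β) h) : CechDR E U (k + 1)) =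
          cls (totalD U) (k + 1)
            (single U 0 (k + 1) (Nat.zero_add (k + 1)) (cechD U 0 k (ofFamily U k β))) h₀) ∧
        (∃ h₂, Φ (cls (tildeD π U) k (tilde π U α β) h) =
          cls (relD π) k (Submodule.Quotient.mk α) h₂) := by
  obtain ⟨ρ, hρ⟩ := hρ
  -- In degree `k + 1` the coboundaries are by definition the range of the preceding map, and the
  -- Poincaré lemma applies.
  obtain ⟨k, rfl⟩ := Nat.exists_eq_add_of_le' hk
  exact exists_cohomology_equivs hπ hU (smoothlyContractible_top A) ρ hρ
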